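/- Let $\mathcal A=\{a_i : i\ge 1\}$ be a countably infinite alphabet and, for each $n\ge 1$, let $\mathbf P_n=\{p_{n,i}: i\ge 1\}$ be a probability distribution on $\mathcal A$ (some $p_{n,i}$ may be zero). For each $n\ge1$ let $X_{1,n},\dots,X_{n,n}$ be independent and identically distributed $\mathcal A$-valued random variables with $\mathbb P(X_{1,n}=a_i)=p_{n,i}$, and let $\hat p_{n,i}=\frac1n\sum_{k=1}^n \mathbf 1_{\{X_{k,n}=a_i\}}$. Let $\beta\in(0,1]$ and let $g:[0,1]\to\mathbb R$ be differentiable with $\beta$-Hölder continuous derivative, i.e. for some $M>0$, $|g'(x)-g'(y)|\le M|x-y|^\beta$ for all $x,y\in[0,1]$ (derivatives at the endpoints are one-sided). Assume $\sum_{i}|g(p_{n,i})|<\infty$ for each $n\ge1$, and put $$\theta_n=\sum_{i=1}^\infty g(p_{n,i}),\qquad \hat\theta_n=\sum_{i=1}^\infty g(\hat p_{n,i}),$$ $$\sigma_n^2=\sum_{i=1}^\infty p_{n,i}\,g'(p_{n,i})^2-\Bigl(\sum_{i=1}^\infty p_{n,i}\,g'(p_{n,i})\Bigr)^2,\quad \sigma_n\ge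 0,\qquad \gamma=\begin{cases}\beta/2,&\beta\in(0,1/2],\\ \beta-1/2,&\beta\in(1/2,1].\end{cases}$$ Suppose that either 1. $\beta\in(1/2,1]$, or 2. $\beta\in(0,1/2]$ and $\sup_{n\ge1}\sum_{i=1}^\infty p_{n,i}^{(\beta+1)/2}<\infty$. Then there is a constant $C>0$, not depending on $n$, such that for every $n\ge1$ with $\sigma_n>0$, $$\sup_{x\in\mathbb R}\left|\mathbb P\left(\frac{\sqrt n}{\sigma_n}(\hat\theta_n-\theta_n)\le x\right)-\Phi(x)\right|\le\frac{C}{n^{\gamma/2}\sigma_n^{1/2}},$$ where $\Phi$ is the standard normal distribution function. -/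

import Mathlib

open MeasureTheory ProbabilityTheory Set
open scoped ENNReal

noncomputable section

/-- `f` is `β`-Hölder continuous on the unit interval. -/
def HolderUnit (β : ℝ) (f : ℝ → ℝ) : Prop :=
  ∃ M : ℝ, 0 < M ∧ ∀ x ∈ Icc (0 : ℝ) 1, ∀ y ∈ Icc (0 : ℝ) 1, |f x - f y| ≤ M * |x - y| ^ β

/-- The derivative of a function on `[0,1]` (one-sided at the two endpoints). -/
def unitDeriv (g : ℝ → ℝ) (x : ℝ) : ℝ := derivWithin g (Icc (0 : ℝ) 1) x

/-- The diversity index `∑ g(q_i)`. -/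
def diversityIndex (g : ℝ → ℝ) (q : ℕ → ℝ) : ℝ := ∑' i, g (q i)

/-- The proportion of the `n` sample points that equal the letter `b`. -/
def sampleProportion {Ω A : Type*} {n : ℕ} (X : Fin n → Ω → A) (b : A) (ω : Ω) : ℝ :=
  (1 / (n : ℝ)) * ∑ k : Fin n, ({ω' | X k ω' = b}).indicator (fun _ => (1 : ℝ)) ω

/-- The plug-in estimator: the index of the sample proportions of the letters `a 0, a 1, …`. -/
def plugIn {Ω A : Type*} {n : ℕ} (g : ℝ → ℝ) (a : ℕ → A) (X : Fin n → Ω → A) (ω : Ω) : ℝ :=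
  diversityIndex g (fun i => sampleProportion X (a i) ω)

/-- `σ² = ∑ q_i g'(q_i)² - (∑ q_i g'(q_i))²`. -/
def sigmaSq (g : ℝ → ℝ) (q : ℕ → ℝ) : ℝ :=
  (∑' i, q i * (unitDeriv g (q i)) ^ 2) - (∑' i, q i * unitDeriv g (q i)) ^ 2

/-- The standard deviation `σ ≥ 0`. -/
def sigma (g : ℝ → ℝ) (q : ℕ → ℝ) : ℝ := Real.sqrt (sigmaSq g q)

/-- The rate exponent: `β/2` for `β ≤ 1/2` and `β - 1/2` for `β > 1/2`. -/
def rateExponent (β : ℝ) : ℝ := if β ≤ 1 / 2 then β / 2 else β - 1 / 2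

/-- The distribution function of the standard normal law. -/
def stdNormalCdf (x : ℝ) : ℝ := cdf (gaussianReal 0 1) x

end

/-! Expand each `g (p̂ i)` to first order at `p i`. The linear terms add up to the mean of the
i.i.d. bounded variables `g' (p i)`, taken at the sampled letters and centred; one draw has variance
`σ²`. So the normalised estimator is a sum of independent variables of size `O(1 / (√n σ))` and
total variance one, plus a remainder.

The Hölder condition bounds the remainder by a multiple of `∑ |p̂ i - p i| ^ (β + 1)`. There are two
moment estimates for its terms. One is linear in `p i`, sums for every distribution, and gives `√n ·
n ^ (-β)` after normalisation. The other is of order `(p i / n) ^ ((β + 1) / 2)`, needs the supremum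
hypothesis, and gives `n ^ (-β / 2)`. These are the two branches of `γ`
(`exists_summable_moment_bound`).

Stein's method (`abs_integral_sum_sub_integral_gaussian_le`) compares the independent sum with the
Gaussian on Lipschitz test functions. Replacing the indicator of a half-line by a ramp of width `ε`
costs `ε` by the bounded Gaussian density. It also makes the test function `1 / ε`-Lipschitz, so a
remainder of mean size `r` costs only `r / ε` (`abs_measureReal_sub_stdNormalCdf_le`). Since `r` is
of order `n ^ (-γ) / σ`, balancing `ε` against `r / ε` gives `ε = √(n ^ (-γ) / σ)`, which is the
claimed rate; this is where the exponents `γ / 2` and `1 / 2` come from. -/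

/-! ### The standard Gaussian density and the Stein equation -/

lemma hasDerivAt_stdGaussianPDFReal (x : ℝ) :
    HasDerivAt (gaussianPDFReal 0 1) (-(x * gaussianPDFReal 0 1 x)) x := by
  have h1 : HasDerivAt (fun y : ℝ => -y ^ 2 / 2) (-x) x := by
    refine ((hasDerivAt_pow 2 x).fun_neg.div_const 2).congr_deriv ?_
    norm_num
    ring
  have h2 := (h1.exp.const_mul (Real.sqrt (2 * Real.pi))⁻¹)
  have e : gaussianPDFReal 0 1 = fun x => (√(2 * Real.pi))⁻¹ * Real.exp (-x ^ 2 / 2) := by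
    ext x; simp [gaussianPDFReal]
  rw [e]
  refine h2.congr_deriv ?_
  ring

lemma continuous_stdGaussianPDFReal : Continuous (gaussianPDFReal 0 1) :=
  continuous_iff_continuousAt.2 fun x => (hasDerivAt_stdGaussianPDFReal x).continuousAt

lemma integrable_mul_stdGaussianPDFReal :
    Integrable (fun x : ℝ => x * gaussianPDFReal 0 1 x) := by
  have h := (integrable_mul_exp_neg_mul_sq (b := 1 / 2) (by norm_num)).const_mul
    (√(2 * Real.pi))⁻¹
  refine h.congr (.of_forall fun x => ?_)
  simp only [gaussianPDFReal, NNReal.coe_one, mul_one, sub_zero]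
  rw [show -(1 / 2) * x ^ 2 = -x ^ 2 / 2 by ring]
  ring

lemma integral_Ioi_mul_stdGaussianPDFReal (a : ℝ) :
    ∫ x in Ioi a, x * gaussianPDFReal 0 1 x = gaussianPDFReal 0 1 a := by
  have hd (x : ℝ) : HasDerivAt (fun y => -gaussianPDFReal 0 1 y) (x * gaussianPDFReal 0 1 x) x := by
    simpa using (hasDerivAt_stdGaussianPDFReal x).fun_neg
  have ht := tendsto_zero_of_hasDerivAt_of_integrableOn_Ioi (a := a) (fun x _ => hd x)
    integrable_mul_stdGaussianPDFReal.integrableOn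
    (integrable_gaussianPDFReal 0 1).neg.integrableOn
  rw [integral_Ioi_of_hasDerivAt_of_tendsto (hd a).continuousAt.continuousWithinAt
    (fun x _ => hd x) integrable_mul_stdGaussianPDFReal.integrableOn ht]
  simp

lemma integral_Iic_mul_stdGaussianPDFReal (a : ℝ) :
    ∫ x in Iic a, x * gaussianPDFReal 0 1 x = -gaussianPDFReal 0 1 a := by
  have hd (x : ℝ) : HasDerivAt (fun y => -gaussianPDFReal 0 1 y) (x * gaussianPDFReal 0 1 x) x := by
    simpa using (hasDerivAt_stdGaussianPDFReal x).fun_neg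
  have ht := tendsto_zero_of_hasDerivAt_of_integrableOn_Iic (a := a) (fun x _ => hd x)
    integrable_mul_stdGaussianPDFReal.integrableOn
    (integrable_gaussianPDFReal 0 1).neg.integrableOn
  rw [integral_Iic_of_hasDerivAt_of_tendsto (hd a).continuousAt.continuousWithinAt
    (fun x _ => hd x) integrable_mul_stdGaussianPDFReal.integrableOn ht]
  simp

/-- On this interval the density is at least `0.38 * 0.6 > 1 / 5`. This controls the Stein solution
near the origin, where a bound on `x * f x` says nothing about `f x`. -/
lemma one_le_five_mul_stdGaussianPDFReal {x : ℝ} (hx : |x| ≤ 1) :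
    1 ≤ 5 * gaussianPDFReal 0 1 x := by
  have h1 : √(2 * Real.pi) ≤ 2.6 := by
    rw [Real.sqrt_le_left (by norm_num)]
    nlinarith [Real.pi_lt_d2]
  have h0 : 0 < √(2 * Real.pi) := by positivity
  have h3 : (0.38 : ℝ) ≤ 1 / √(2 * Real.pi) := by
    rw [le_div_iff₀ h0]; nlinarith
  have h4 : Real.exp (-(1 / 2)) ≤ Real.exp (-x ^ 2 / 2) := by
    apply Real.exp_le_exp.2
    have hx2 : x ^ 2 ≤ 1 := by rwa [sq_le_one_iff_abs_le_one]
    linarith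
  have h5 : (0.6 : ℝ) ≤ Real.exp (-(1 / 2)) := by
    have hq : Real.exp (-(1 / 2)) * Real.exp (-(1 / 2)) = Real.exp (-1) := by
      rw [← Real.exp_add]; norm_num
    have := Real.exp_neg_one_gt_d9
    have hp := Real.exp_pos (-(1 / 2))
    nlinarith
  have e : gaussianPDFReal 0 1 x = 1 / √(2 * Real.pi) * Real.exp (-x ^ 2 / 2) := by
    simp [gaussianPDFReal]
  rw [e]
  nlinarith

/-- The Stein equation of the standard normal law has a bounded solution for every continuous
right-hand side with values in the unit interval. -/
lemma exists_stein_solution {h : ℝ → ℝ} (hc : Continuous h) (h0 : ∀ x, 0 ≤ h x)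
    (h1 : ∀ x, h x ≤ 1) :
    ∃ f : ℝ → ℝ, (∀ x, HasDerivAt f (x * f x + h x - ∫ y, h y ∂gaussianReal 0 1) x) ∧
      (∀ x, |f x| ≤ 5) ∧ ∀ x, |x * f x| ≤ 1 := by
  set m := ∫ y, h y ∂gaussianReal 0 1 with hm
  set φ := gaussianPDFReal 0 1 with hφ
  have φpos (x : ℝ) : 0 < φ x := gaussianPDFReal_pos 0 1 x one_ne_zero
  have φint : Integrable φ := integrable_gaussianPDFReal 0 1
  have hint : Integrable h (gaussianReal 0 1) :=
    Integrable.of_bound hc.aestronglyMeasurable 1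
      (.of_forall fun x => by rw [Real.norm_eq_abs, abs_of_nonneg (h0 x)]; exact h1 x)
  have hm0 : 0 ≤ m := integral_nonneg h0
  have hm1 : m ≤ 1 := by
    calc m ≤ ∫ y, (1 : ℝ) ∂gaussianReal 0 1 := integral_mono hint (integrable_const 1) h1
      _ = 1 := by simp
  have hb (x : ℝ) : |h x - m| ≤ 1 := by
    rw [abs_le]; constructor <;> linarith [h0 x, h1 x]
  set w : ℝ → ℝ := fun x => (h x - m) * φ x with hw
  have wcont : Continuous w := (hc.sub continuous_const).mul continuous_stdGaussianPDFReal
  have wle (x : ℝ) : |w x| ≤ φ x := by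
    rw [hw, abs_mul, abs_of_pos (φpos x)]
    exact mul_le_of_le_one_left (φpos x).le (hb x)
  have wint : Integrable w := φint.mono' wcont.aestronglyMeasurable (.of_forall wle)
  have wzero : ∫ x, w x = 0 := by
    have : ∫ y, (h y - m) ∂gaussianReal 0 1 = 0 := by
      rw [integral_sub hint (integrable_const m)]; simp [hm]
    rw [integral_gaussianReal_eq_integral_smul one_ne_zero] at this
    rw [← this]
    exact integral_congr_ae (.of_forall fun x => by simp [hw, hφ, mul_comm])
  set F : ℝ → ℝ := fun x => ∫ t in Iic x, w t with hF
  have hF' (x : ℝ) : HasDerivAt F (w x) x := by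
    have e : F = fun x => F 0 + ∫ t in (0 : ℝ)..x, w t := by
      ext x
      rw [← intervalIntegral.integral_Iic_sub_Iic wint.integrableOn wint.integrableOn]
      simp [hF]
    rw [e]
    exact (intervalIntegral.integral_hasDerivAt_right (wcont.intervalIntegrable _ _)
      (wcont.stronglyMeasurableAtFilter _ _) wcont.continuousAt).const_add _
  -- Since `w` has total integral zero, `F` is also a right tail, so one may always integrate over
  -- the tail on which `|t| ≥ |x|`.
  have hFi (x : ℝ) : F x = -∫ t in Ioi x, w t := by
    have := intervalIntegral.integral_Iic_add_Ioi (b := x) wint.integrableOn wint.integrableOn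
    rw [wzero] at this
    simp only [hF]; linarith
  have hF1 (x : ℝ) : |F x| ≤ 1 := by
    calc |F x| ≤ ∫ t in Iic x, |w t| := abs_integral_le_integral_abs
      _ ≤ ∫ t, |w t| := setIntegral_le_integral wint.abs (.of_forall fun t => abs_nonneg _)
      _ ≤ ∫ t, φ t := integral_mono wint.abs φint wle
      _ = 1 := integral_gaussianPDFReal_eq_one 0 one_ne_zero
  -- Inside the tail integral `|x|` is replaced by `|t|`, and `|t| * φ t` integrates to exactly `φ
  -- x` there.
  have hxF (x : ℝ) : |x * F x| ≤ φ x := by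
    rcases le_total 0 x with hx | hx
    · rw [abs_mul, abs_of_nonneg hx, hFi, abs_neg]
      calc x * |∫ t in Ioi x, w t| ≤ x * ∫ t in Ioi x, |w t| := by
            gcongr; exact abs_integral_le_integral_abs
        _ = ∫ t in Ioi x, x * |w t| := (integral_const_mul _ _).symm
        _ ≤ ∫ t in Ioi x, t * φ t := by
            refine setIntegral_mono_on (wint.abs.const_mul x).integrableOn
              integrable_mul_stdGaussianPDFReal.integrableOn measurableSet_Ioi fun t ht => ?_
            exact mul_le_mul ht.le (wle t) (abs_nonneg _) (hx.trans ht.le)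
        _ = φ x := integral_Ioi_mul_stdGaussianPDFReal x
    · rw [abs_mul, abs_of_nonpos hx]
      calc -x * |∫ t in Iic x, w t| ≤ -x * ∫ t in Iic x, |w t| := by
            apply mul_le_mul_of_nonneg_left abs_integral_le_integral_abs; linarith
        _ = ∫ t in Iic x, -x * |w t| := (integral_const_mul _ _).symm
        _ ≤ ∫ t in Iic x, -(t * φ t) := by
            refine setIntegral_mono_on (wint.abs.const_mul (-x)).integrableOn
              integrable_mul_stdGaussianPDFReal.neg.integrableOn measurableSet_Iic fun t ht => ?_
            have ht' : t ≤ x := ht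
            rw [← neg_mul]
            exact mul_le_mul (by linarith) (wle t) (abs_nonneg _) (by linarith)
        _ = φ x := by rw [integral_neg, integral_Iic_mul_stdGaussianPDFReal, neg_neg]
  have hx1 (x : ℝ) : |x * (F x / φ x)| ≤ 1 := by
    rw [← mul_div_assoc, abs_div, abs_of_pos (φpos x), div_le_one (φpos x)]
    exact hxF x
  refine ⟨fun x => F x / φ x, fun x => ?_, fun x => ?_, hx1⟩
  · have := (hF' x).div (hasDerivAt_stdGaussianPDFReal x) (φpos x).ne'
    refine this.congr_deriv ?_
    have hne := (φpos x).ne'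
    rw [← hφ]
    simp only [hw]
    field_simp
    ring
  · rcases le_total |x| 1 with hx | hx
    · rw [abs_div, abs_of_pos (φpos x), div_le_iff₀ (φpos x)]
      exact (hF1 x).trans (one_le_five_mul_stdGaussianPDFReal hx)
    · have := hx1 x
      rw [abs_mul] at this
      nlinarith [abs_nonneg (F x / φ x)]

/-! ### Stein's method for sums of independent bounded variables -/

lemma integrable_of_forall_abs_le {Ω : Type*} [MeasurableSpace Ω] {μ : Measure Ω}
    [IsFiniteMeasure μ] {u : Ω → ℝ} (hu : Measurable u) (C : ℝ) (hC : ∀ ω, |u ω| ≤ C) :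
    Integrable u μ :=
  Integrable.of_bound hu.aestronglyMeasurable C (.of_forall hC)

/-- A function whose derivative grows at most linearly away from a point agrees with its linear
part up to a quadratic error. -/
lemma abs_sub_sub_mul_le_of_deriv_bound {f f' : ℝ → ℝ} (hf : ∀ x, HasDerivAt f (f' x) x) {v D : ℝ}
    (hD : ∀ s, |f' (v + s) - f' v| ≤ |s| * D) (hD0 : 0 ≤ D) (t : ℝ) :
    |f (v + t) - f v - t * f' v| ≤ t ^ 2 * D := by
  have hd (s : ℝ) (_ : s ∈ Icc (-|t|) |t|) :
      HasDerivWithinAt (fun s => f (v + s) - s * f' v) (f' (v + s) - f' v) (Icc (-|t|) |t|) s := by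
    have h1 : HasDerivAt (fun s => f (v + s)) (f' (v + s)) s := (hf (v + s)).comp_const_add v s
    have h2 : HasDerivAt (fun s => s * f' v) (f' v) s := by
      simpa using (hasDerivAt_id s).mul_const (f' v)
    exact (h1.sub h2).hasDerivWithinAt
  have hb (s : ℝ) (hs : s ∈ Icc (-|t|) |t|) : ‖f' (v + s) - f' v‖ ≤ |t| * D :=
    (hD s).trans (mul_le_mul_of_nonneg_right (abs_le.2 hs) hD0)
  have := Convex.norm_image_sub_le_of_norm_hasDerivWithin_le hd hb (convex_Icc _ _)
    (x := 0) (y := t) (by simp) ⟨neg_abs_le t, le_abs_self t⟩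
  simp only [Real.norm_eq_abs, add_zero, zero_mul, sub_zero] at this
  calc |f (v + t) - f v - t * f' v| = |f (v + t) - t * f' v - f v| := by ring_nf
    _ ≤ |t| * D * |t| := this
    _ = t ^ 2 * D := by rw [← sq_abs t]; ring

/-- Expectations of products of a centred bounded variable with a Stein solution. -/
lemma abs_integral_mul_add_sub_le {Ω : Type*} [MeasurableSpace Ω] {μ : Measure Ω}
    [IsProbabilityMeasure μ] {ξ V : Ω → ℝ} (hξ : Measurable ξ) (hV : Measurable V)
    (hind : IndepFun ξ V μ) {B K : ℝ} (hB : ∀ ω, |ξ ω| ≤ B) (hK : ∀ ω, |V ω| ≤ K)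
    (hξ0 : ∫ ω, ξ ω ∂μ = 0) (hV2 : ∫ ω, V ω ^ 2 ∂μ ≤ 1)
    {f f' : ℝ → ℝ} (hf : ∀ x, HasDerivAt f (f' x) x) {a b c : ℝ} (hfa : ∀ x, |f x| ≤ a)
    (hfb : ∀ x, |f' x| ≤ b) (hc : 0 ≤ c)
    (hD : ∀ x s, |f' (x + s) - f' x| ≤ |s| * (c + 2 * |x|)) (hf'c : Continuous f') :
    |∫ ω, ξ ω * f (V ω + ξ ω) ∂μ - (∫ ω, ξ ω ^ 2 ∂μ) * ∫ ω, f' (V ω + ξ ω) ∂μ|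
      ≤ (∫ ω, ξ ω ^ 2 ∂μ) * (2 * B * (c + 2)) := by
  have hfc : Continuous f := continuous_iff_continuousAt.2 fun x => (hf x).continuousAt
  obtain ⟨ω₀⟩ : Nonempty Ω := nonempty_of_isProbabilityMeasure μ
  have hB0 : 0 ≤ B := (abs_nonneg _).trans (hB ω₀)
  have hK0 : 0 ≤ K := (abs_nonneg _).trans (hK ω₀)
  have ha0 : 0 ≤ a := (abs_nonneg _).trans (hfa 0)
  have hξ2 (ω : Ω) : ξ ω ^ 2 ≤ B ^ 2 := sq_le_sq' (abs_le.1 (hB ω)).1 (abs_le.1 (hB ω)).2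
  have mfV : Measurable fun ω => f (V ω) := hfc.measurable.comp hV
  have mfW : Measurable fun ω => f (V ω + ξ ω) := hfc.measurable.comp (hV.add hξ)
  have mf'V : Measurable fun ω => f' (V ω) := hf'c.measurable.comp hV
  have mf'W : Measurable fun ω => f' (V ω + ξ ω) := hf'c.measurable.comp (hV.add hξ)
  have mabs : Measurable fun ω => c + 2 * |V ω| := measurable_const.add (hV.abs.const_mul 2)
  have i1 : Integrable (fun ω => ξ ω * f (V ω)) μ :=
    integrable_of_forall_abs_le (hξ.mul mfV) (B * a) fun ω => by
      rw [abs_mul]; exact mul_le_mul (hB ω) (hfa _) (abs_nonneg _) hB0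
  have i2 : Integrable (fun ω => ξ ω * f (V ω + ξ ω)) μ :=
    integrable_of_forall_abs_le (hξ.mul mfW) (B * a) fun ω => by
      rw [abs_mul]; exact mul_le_mul (hB ω) (hfa _) (abs_nonneg _) hB0
  have i3 : Integrable (fun ω => ξ ω ^ 2 * f' (V ω)) μ :=
    integrable_of_forall_abs_le ((hξ.pow_const 2).mul mf'V) (B ^ 2 * b) fun ω => by
      rw [abs_mul, abs_of_nonneg (sq_nonneg (ξ ω))]
      exact mul_le_mul (hξ2 ω) (hfb _) (abs_nonneg _) (sq_nonneg B)
  have i4 : Integrable (fun ω => f' (V ω)) μ := integrable_of_forall_abs_le mf'V b fun ω => hfb _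
  have i5 : Integrable (fun ω => f' (V ω + ξ ω)) μ :=
    integrable_of_forall_abs_le mf'W b fun ω => hfb _
  have iV : Integrable (fun ω => |V ω|) μ :=
    integrable_of_forall_abs_le hV.abs K fun ω => by rw [abs_abs]; exact hK ω
  have iV2 : Integrable (fun ω => V ω ^ 2) μ :=
    integrable_of_forall_abs_le (hV.pow_const 2) (K ^ 2) fun ω => by
      rw [abs_of_nonneg (sq_nonneg (V ω))]
      exact sq_le_sq' (abs_le.1 (hK ω)).1 (abs_le.1 (hK ω)).2
  have i6 : Integrable (fun ω => c + 2 * |V ω|) μ := (integrable_const c).add (iV.const_mul 2)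
  have i7 : Integrable (fun ω => ξ ω ^ 2 * (c + 2 * |V ω|)) μ :=
    integrable_of_forall_abs_le ((hξ.pow_const 2).mul mabs) (B ^ 2 * (c + 2 * K)) fun ω => by
      rw [abs_of_nonneg (by positivity)]
      have := hK ω
      have := hξ2 ω
      gcongr
  -- From `2 * |V| ≤ 1 + V ^ 2` and the second moment bound.
  have hEV : ∫ ω, (c + 2 * |V ω|) ∂μ ≤ c + 2 := by
    have : ∫ ω, (c + 2 * |V ω|) ∂μ ≤ ∫ ω, (c + 1 + V ω ^ 2) ∂μ := by
      refine integral_mono i6 ((integrable_const (c + 1)).add iV2) fun ω => ?_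
      have := sq_nonneg (|V ω| - 1)
      have := sq_abs (V ω)
      dsimp only
      nlinarith
    rw [integral_add (integrable_const (c + 1)) iV2] at this
    simp at this
    linarith
  have e1 : ∫ ω, ξ ω * f (V ω) ∂μ = 0 := by
    have := (hind.comp measurable_id hfc.measurable).integral_fun_mul_eq_mul_integral
      hξ.aestronglyMeasurable mfV.aestronglyMeasurable
    simpa [hξ0] using this
  have e2 : ∫ ω, ξ ω ^ 2 * f' (V ω) ∂μ = (∫ ω, ξ ω ^ 2 ∂μ) * ∫ ω, f' (V ω) ∂μ :=
    (hind.comp (measurable_id.pow_const 2) hf'c.measurable).integral_fun_mul_eq_mul_integral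
      (hξ.pow_const 2).aestronglyMeasurable mf'V.aestronglyMeasurable
  have e3 : ∫ ω, ξ ω ^ 2 * (c + 2 * |V ω|) ∂μ
      = (∫ ω, ξ ω ^ 2 ∂μ) * ∫ ω, (c + 2 * |V ω|) ∂μ :=
    (hind.comp (ψ := fun x => c + 2 * |x|) (measurable_id.pow_const 2)
      (by fun_prop)).integral_fun_mul_eq_mul_integral
      (hξ.pow_const 2).aestronglyMeasurable mabs.aestronglyMeasurable
  have hs0 : 0 ≤ ∫ ω, ξ ω ^ 2 ∂μ := integral_nonneg fun ω => sq_nonneg _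
  -- Subtracting `ξ * f V`, which has mean zero by independence, leaves `ξ` times a second-order
  -- Taylor error. Replacing `f' V` by `f' (V + ξ)` below costs as much again, whence the factor 2.
  have hfirst : |∫ ω, ξ ω * f (V ω + ξ ω) ∂μ - ∫ ω, ξ ω ^ 2 * f' (V ω) ∂μ|
      ≤ (∫ ω, ξ ω ^ 2 ∂μ) * (B * (c + 2)) := by
    have : ∫ ω, ξ ω * f (V ω + ξ ω) ∂μ - ∫ ω, ξ ω ^ 2 * f' (V ω) ∂μ
        = ∫ ω, (ξ ω * f (V ω + ξ ω) - ξ ω * f (V ω) - ξ ω ^ 2 * f' (V ω)) ∂μ := by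
      have i21 : Integrable (fun ω => ξ ω * f (V ω + ξ ω) - ξ ω * f (V ω)) μ := i2.sub i1
      rw [integral_sub i21 i3, integral_sub i2 i1, e1, sub_zero]
    rw [this]
    calc _ ≤ ∫ ω, |ξ ω * f (V ω + ξ ω) - ξ ω * f (V ω) - ξ ω ^ 2 * f' (V ω)| ∂μ :=
          abs_integral_le_integral_abs
      _ ≤ ∫ ω, B * (ξ ω ^ 2 * (c + 2 * |V ω|)) ∂μ := by
          refine integral_mono ((i2.sub i1).sub i3).abs (i7.const_mul B) fun ω => ?_
          have h := abs_sub_sub_mul_le_of_deriv_bound hf (hD (V ω)) (by positivity) (ξ ω)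
          dsimp only
          rw [show ξ ω * f (V ω + ξ ω) - ξ ω * f (V ω) - ξ ω ^ 2 * f' (V ω)
            = ξ ω * (f (V ω + ξ ω) - f (V ω) - ξ ω * f' (V ω)) by ring, abs_mul]
          exact mul_le_mul (hB ω) h (abs_nonneg _) hB0
      _ = B * ((∫ ω, ξ ω ^ 2 ∂μ) * ∫ ω, (c + 2 * |V ω|) ∂μ) := by
          rw [integral_const_mul, e3]
      _ ≤ B * ((∫ ω, ξ ω ^ 2 ∂μ) * (c + 2)) := by gcongr
      _ = _ := by ring
  have hsecond : |∫ ω, f' (V ω) ∂μ - ∫ ω, f' (V ω + ξ ω) ∂μ| ≤ B * (c + 2) := by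
    rw [← integral_sub i4 i5]
    calc _ ≤ ∫ ω, |f' (V ω) - f' (V ω + ξ ω)| ∂μ := abs_integral_le_integral_abs
      _ ≤ ∫ ω, B * (c + 2 * |V ω|) ∂μ := by
          refine integral_mono (i4.sub i5).abs (i6.const_mul B) fun ω => ?_
          dsimp only
          rw [abs_sub_comm]
          exact (hD _ _).trans (mul_le_mul_of_nonneg_right (hB ω) (by positivity))
      _ = B * ∫ ω, (c + 2 * |V ω|) ∂μ := integral_const_mul _ _
      _ ≤ B * (c + 2) := by gcongr
  calc _ = |(∫ ω, ξ ω * f (V ω + ξ ω) ∂μ - ∫ ω, ξ ω ^ 2 * f' (V ω) ∂μ)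
        + (∫ ω, ξ ω ^ 2 ∂μ) * (∫ ω, f' (V ω) ∂μ - ∫ ω, f' (V ω + ξ ω) ∂μ)| := by
          rw [e2]; ring_nf
    _ ≤ _ := abs_add_le _ _
    _ ≤ (∫ ω, ξ ω ^ 2 ∂μ) * (B * (c + 2)) + (∫ ω, ξ ω ^ 2 ∂μ) * (B * (c + 2)) := by
        rw [abs_mul, abs_of_nonneg hs0]
        gcongr
    _ = _ := by ring

/-- Variance of a sum of centred bounded pairwise independent variables. -/
lemma integral_sum_sq_eq_sum {Ω ι : Type*} [MeasurableSpace Ω] {μ : Measure Ω}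
    [IsProbabilityMeasure μ] {ξ : ι → Ω → ℝ} (hm : ∀ k, Measurable (ξ k)) (hind : iIndepFun ξ μ)
    {B : ℝ} (hB : ∀ k ω, |ξ k ω| ≤ B) (h0 : ∀ k, ∫ ω, ξ k ω ∂μ = 0) (s : Finset ι) :
    ∫ ω, (∑ k ∈ s, ξ k ω) ^ 2 ∂μ = ∑ k ∈ s, ∫ ω, ξ k ω ^ 2 ∂μ := by
  have hL (k : ι) : MemLp (ξ k) 2 μ :=
    MemLp.of_bound (hm k).aestronglyMeasurable B (.of_forall (hB k))
  have hi (k : ι) : Integrable (ξ k) μ := (hL k).integrable (by norm_num)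
  have h := IndepFun.variance_sum (s := s) (fun k _ => hL k)
    (fun i _ j _ hij => hind.indepFun hij)
  rw [variance_of_integral_eq_zero (by fun_prop)] at h
  · simp only [Finset.sum_apply] at h
    rw [h]
    exact Finset.sum_congr rfl fun k _ =>
      variance_of_integral_eq_zero (hm k).aemeasurable (h0 k)
  · simp only [Finset.sum_apply]
    rw [integral_finsetSum _ fun k _ => hi k]
    simp [h0]

/-- Normal approximation, for Lipschitz test functions with values in the unit interval, of a sum
of independent centred bounded variables of total variance one. -/
lemma abs_integral_sum_sub_integral_gaussian_le {Ω ι : Type*} [Fintype ι] [MeasurableSpace Ω]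
    {μ : Measure Ω} [IsProbabilityMeasure μ] {ξ : ι → Ω → ℝ} (hm : ∀ k, Measurable (ξ k))
    (hind : iIndepFun ξ μ) {B : ℝ} (hB : ∀ k ω, |ξ k ω| ≤ B) (h0 : ∀ k, ∫ ω, ξ k ω ∂μ = 0)
    (h1 : ∑ k, ∫ ω, ξ k ω ^ 2 ∂μ = 1) {h : ℝ → ℝ} (hc : Continuous h) (hh0 : ∀ x, 0 ≤ h x)
    (hh1 : ∀ x, h x ≤ 1) {L : ℝ} (hL0 : 0 ≤ L) (hL : ∀ x y, |h x - h y| ≤ L * |x - y|) :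
    |∫ ω, h (∑ k, ξ k ω) ∂μ - ∫ x, h x ∂gaussianReal 0 1| ≤ 2 * B * (7 + L) := by
  classical
  obtain ⟨f, hf, hf5, hxf⟩ := exists_stein_solution hc hh0 hh1
  set m := ∫ x, h x ∂gaussianReal 0 1 with hmdef
  have hint : Integrable h (gaussianReal 0 1) :=
    Integrable.of_bound hc.aestronglyMeasurable 1
      (.of_forall fun x => by rw [Real.norm_eq_abs, abs_of_nonneg (hh0 x)]; exact hh1 x)
  have hm0 : 0 ≤ m := integral_nonneg hh0
  have hm1 : m ≤ 1 := by
    calc m ≤ ∫ y, (1 : ℝ) ∂gaussianReal 0 1 := integral_mono hint (integrable_const 1) hh1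
      _ = 1 := by simp
  set f' : ℝ → ℝ := fun x => x * f x + h x - m with hf'
  have hfc : Continuous f := continuous_iff_continuousAt.2 fun x => (hf x).continuousAt
  have hf'c : Continuous f' := by fun_prop
  have hf'2 (x : ℝ) : |f' x| ≤ 2 := by
    have := abs_le.1 (hxf x)
    rw [abs_le]
    simp only [hf']
    constructor <;> linarith [hh0 x, hh1 x]
  have hfl (x y : ℝ) : |f y - f x| ≤ 2 * |y - x| :=
    Convex.norm_image_sub_le_of_norm_hasDerivWithin_le (s := univ)
      (fun x _ => (hf x).hasDerivWithinAt) (fun x _ => hf'2 x) convex_univ (mem_univ x) (mem_univ y)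
  -- No second derivative is available, as `h` is only Lipschitz; the modulus of continuity of `f'`
  -- is read off the Stein equation.
  have hD (x s : ℝ) : |f' (x + s) - f' x| ≤ |s| * ((5 + L) + 2 * |x|) := by
    have e : f' (x + s) - f' x
        = s * f (x + s) + x * (f (x + s) - f x) + (h (x + s) - h x) := by
      simp only [hf']; ring
    have a1 : |s * f (x + s)| ≤ |s| * 5 := by
      rw [abs_mul]; exact mul_le_mul_of_nonneg_left (hf5 _) (abs_nonneg s)
    have a2 : |x * (f (x + s) - f x)| ≤ |x| * (2 * |s|) := by
      rw [abs_mul]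
      have := hfl x (x + s)
      rw [add_sub_cancel_left] at this
      exact mul_le_mul_of_nonneg_left this (abs_nonneg x)
    have a3 : |h (x + s) - h x| ≤ L * |s| := by simpa using hL (x + s) x
    rw [e]
    calc _ ≤ |s * f (x + s)| + |x * (f (x + s) - f x)| + |h (x + s) - h x| := abs_add_three _ _ _
      _ ≤ |s| * 5 + |x| * (2 * |s|) + L * |s| := by gcongr
      _ = _ := by ring
  have mW : Measurable fun ω => ∑ k, ξ k ω := Finset.measurable_fun_sum _ fun k _ => hm k
  have hsum (k : ι) (ω : Ω) : ∑ j, ξ j ω = (∑ j ∈ Finset.univ.erase k, ξ j ω) + ξ k ω :=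
    (Finset.sum_erase_add _ _ (Finset.mem_univ k)).symm
  have key (k : ι) : |∫ ω, ξ k ω * f (∑ j, ξ j ω) ∂μ
      - (∫ ω, ξ k ω ^ 2 ∂μ) * ∫ ω, f' (∑ j, ξ j ω) ∂μ|
      ≤ (∫ ω, ξ k ω ^ 2 ∂μ) * (2 * B * ((5 + L) + 2)) := by
    have hi : IndepFun (ξ k) (fun ω => ∑ j ∈ Finset.univ.erase k, ξ j ω) μ := by
      have := (hind.indepFun_finsetSum_of_notMem hm (Finset.notMem_erase k Finset.univ)).symm
      convert this using 1
      ext ω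
      simp
    have hV2 : ∫ ω, (∑ j ∈ Finset.univ.erase k, ξ j ω) ^ 2 ∂μ ≤ 1 := by
      rw [integral_sum_sq_eq_sum hm hind hB h0, ← h1]
      exact Finset.sum_le_sum_of_subset_of_nonneg (Finset.erase_subset _ _)
        fun j _ _ => integral_nonneg fun ω => sq_nonneg _
    simp only [hsum k]
    exact abs_integral_mul_add_sub_le (hm k) (Finset.measurable_fun_sum _ fun j _ => hm j) hi (hB k)
      -- This crude bound only serves integrability and does not enter the estimate.
      (K := (Finset.univ.erase k).card • B)
      (fun ω => (Finset.abs_sum_le_sum_abs _ _).trans (Finset.sum_le_card_nsmul _ _ _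
        fun j _ => hB j ω)) (h0 k) hV2 hf hf5 hf'2 (by positivity) hD hf'c
  have iξf (k : ι) : Integrable (fun ω => ξ k ω * f (∑ j, ξ j ω)) μ :=
    integrable_of_forall_abs_le ((hm k).mul (hfc.measurable.comp mW)) (B * 5) fun ω => by
      rw [abs_mul]
      exact mul_le_mul (hB k ω) (hf5 _) (abs_nonneg _) ((abs_nonneg _).trans (hB k ω))
  have ih : Integrable (fun ω => h (∑ j, ξ j ω)) μ :=
    integrable_of_forall_abs_le (hc.measurable.comp mW) 1 fun ω => by
      rw [abs_of_nonneg (hh0 _)]; exact hh1 _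
  have iWf : Integrable (fun ω => (∑ k, ξ k ω) * f (∑ j, ξ j ω)) μ := by
    simp only [Finset.sum_mul]
    exact integrable_finsetSum _ fun k _ => iξf k
  -- The Stein equation integrated along the sum: the wanted difference is `E f'(W) - E W f(W)`, and
  -- total variance one spreads `E f'(W)` over the summands.
  have e1 : ∫ ω, f' (∑ j, ξ j ω) ∂μ
      = (∑ k, ∫ ω, ξ k ω * f (∑ j, ξ j ω) ∂μ) + (∫ ω, h (∑ j, ξ j ω) ∂μ - m) := by
    rw [← integral_finsetSum _ fun k _ => iξf k]
    simp only [hf', ← Finset.sum_mul]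
    rw [integral_sub (iWf.fun_add ih) (integrable_const m), integral_add iWf ih]
    simp
    ring
  calc |∫ ω, h (∑ k, ξ k ω) ∂μ - m|
      = |∑ k, (∫ ω, ξ k ω * f (∑ j, ξ j ω) ∂μ
          - (∫ ω, ξ k ω ^ 2 ∂μ) * ∫ ω, f' (∑ j, ξ j ω) ∂μ)| := by
        rw [Finset.sum_sub_distrib, ← Finset.sum_mul, h1, one_mul, e1, abs_sub_comm]
        ring_nf
    _ ≤ ∑ k, (∫ ω, ξ k ω ^ 2 ∂μ) * (2 * B * ((5 + L) + 2)) :=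
        (Finset.abs_sum_le_sum_abs _ _).trans (Finset.sum_le_sum fun k _ => key k)
    _ = 2 * B * (7 + L) := by
        rw [← Finset.sum_mul, h1]; ring

/-! ### From Lipschitz test functions to distribution functions -/

/-- The continuous function equal to `1` up to `z`, to `0` from `z + ε` on, and affine between. -/
noncomputable def ramp (z ε x : ℝ) : ℝ := max 0 (min 1 ((z + ε - x) / ε))

lemma ramp_nonneg (z ε x : ℝ) : 0 ≤ ramp z ε x := le_max_left _ _

lemma ramp_le_one (z ε x : ℝ) : ramp z ε x ≤ 1 := max_le zero_le_one (min_le_left _ _)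

lemma continuous_ramp (z ε : ℝ) : Continuous (ramp z ε) := by
  unfold ramp; fun_prop

lemma ramp_eq_one {z ε x : ℝ} (hε : 0 < ε) (hx : x ≤ z) : ramp z ε x = 1 := by
  have : 1 ≤ (z + ε - x) / ε := by rw [one_le_div hε]; linarith
  rw [ramp, min_eq_left this, max_eq_right zero_le_one]

lemma ramp_eq_zero {z ε x : ℝ} (hε : 0 < ε) (hx : z + ε < x) : ramp z ε x = 0 :=
  max_eq_left <| (min_le_right _ _).trans
    (div_nonpos_of_nonpos_of_nonneg (by linarith) hε.le)

lemma abs_ramp_sub_ramp_le {z ε : ℝ} (hε : 0 < ε) (x y : ℝ) :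
    |ramp z ε x - ramp z ε y| ≤ 1 / ε * |x - y| := by
  calc |ramp z ε x - ramp z ε y|
      ≤ |min 1 ((z + ε - x) / ε) - min 1 ((z + ε - y) / ε)| := by
        simpa [ramp, max_comm] using
          abs_max_sub_max_le_abs (min 1 ((z + ε - x) / ε)) (min 1 ((z + ε - y) / ε)) 0
    _ ≤ |(z + ε - x) / ε - (z + ε - y) / ε| := by
        simpa using abs_min_sub_min_le_max 1 ((z + ε - x) / ε) 1 ((z + ε - y) / ε)
    _ = 1 / ε * |x - y| := by
        rw [← sub_div, abs_div, abs_of_pos hε, abs_sub_comm]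
        ring_nf

lemma integrable_ramp_comp {Ω : Type*} [MeasurableSpace Ω] {μ : Measure Ω} [IsProbabilityMeasure μ]
    {T : Ω → ℝ} (hT : Measurable T) (z ε : ℝ) : Integrable (fun ω => ramp z ε (T ω)) μ :=
  integrable_of_forall_abs_le ((continuous_ramp z ε).measurable.comp hT) 1 fun ω => by
    rw [abs_of_nonneg (ramp_nonneg _ _ _)]; exact ramp_le_one _ _ _

lemma measureReal_le_integral_ramp {Ω : Type*} [MeasurableSpace Ω] {μ : Measure Ω}
    [IsProbabilityMeasure μ] {T : Ω → ℝ} (hT : Measurable T) {ε : ℝ} (hε : 0 < ε) (z : ℝ) :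
    μ.real {ω | T ω ≤ z} ≤ ∫ ω, ramp z ε (T ω) ∂μ := by
  have hs : MeasurableSet {ω | T ω ≤ z} := measurableSet_le hT measurable_const
  rw [← integral_indicator_one hs]
  refine integral_mono ((integrable_const (1 : ℝ)).indicator hs) (integrable_ramp_comp hT z ε)
    fun ω => ?_
  by_cases h : T ω ≤ z
  · rw [indicator_of_mem (by exact h), Pi.one_apply, ramp_eq_one hε h]
  · rw [indicator_of_notMem (by exact h)]; exact ramp_nonneg _ _ _

lemma integral_ramp_le_measureReal {Ω : Type*} [MeasurableSpace Ω] {μ : Measure Ω}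
    [IsProbabilityMeasure μ] {T : Ω → ℝ} (hT : Measurable T) {ε : ℝ} (hε : 0 < ε) (z : ℝ) :
    ∫ ω, ramp z ε (T ω) ∂μ ≤ μ.real {ω | T ω ≤ z + ε} := by
  have hs : MeasurableSet {ω | T ω ≤ z + ε} := measurableSet_le hT measurable_const
  rw [← integral_indicator_one hs]
  refine integral_mono (integrable_ramp_comp hT z ε) ((integrable_const (1 : ℝ)).indicator hs)
    fun ω => ?_
  by_cases h : T ω ≤ z + ε
  · rw [indicator_of_mem (by exact h)]; exact ramp_le_one _ _ _
  · rw [indicator_of_notMem (by exact h), ramp_eq_zero hε (not_le.1 h)]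

lemma stdNormalCdf_eq (x : ℝ) : stdNormalCdf x = (gaussianReal 0 1).real (Iic x) :=
  cdf_eq_real _ _

lemma stdNormalCdf_mem_Icc (x : ℝ) : stdNormalCdf x ∈ Icc (0 : ℝ) 1 := by
  rw [stdNormalCdf_eq]; exact ⟨measureReal_nonneg, measureReal_le_one⟩

lemma stdGaussianPDFReal_le_one (x : ℝ) : gaussianPDFReal 0 1 x ≤ 1 := by
  have e : gaussianPDFReal 0 1 x = (√(2 * Real.pi))⁻¹ * Real.exp (-x ^ 2 / 2) := by
    simp [gaussianPDFReal]
  rw [e]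
  have h1 : (√(2 * Real.pi))⁻¹ ≤ 1 :=
    inv_le_one_of_one_le₀ (Real.one_le_sqrt.2 (by linarith [Real.pi_gt_three]))
  have h2 : Real.exp (-x ^ 2 / 2) ≤ 1 :=
    Real.exp_le_one_iff.2 (by linarith [sq_nonneg x])
  exact mul_le_one₀ h1 (Real.exp_pos _).le h2

lemma stdNormalCdf_add_le {ε : ℝ} (hε : 0 ≤ ε) (x : ℝ) :
    stdNormalCdf (x + ε) ≤ stdNormalCdf x + ε := by
  rw [stdNormalCdf_eq, stdNormalCdf_eq, ← Iic_union_Ioc_eq_Iic (le_add_of_nonneg_right hε)]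
  refine (measureReal_union_le _ _).trans (add_le_add le_rfl ?_)
  rw [measureReal_def, gaussianReal_apply_eq_integral 0 one_ne_zero, ENNReal.toReal_ofReal
    (integral_nonneg fun x => gaussianPDFReal_nonneg 0 1 x)]
  calc ∫ x in Ioc x (x + ε), gaussianPDFReal 0 1 x
      ≤ ∫ _ in Ioc x (x + ε), (1 : ℝ) :=
        setIntegral_mono (integrable_gaussianPDFReal 0 1).integrableOn
          (by simp) stdGaussianPDFReal_le_one
    _ = ε := by simp [hε]

/-- A bound of Berry–Esseen type for a perturbed sum of independent bounded variables. -/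
lemma abs_measureReal_sub_stdNormalCdf_le {Ω ι : Type*} [Fintype ι] [MeasurableSpace Ω]
    {μ : Measure Ω} [IsProbabilityMeasure μ] {ξ : ι → Ω → ℝ} (hm : ∀ k, Measurable (ξ k))
    (hind : iIndepFun ξ μ) {B : ℝ} (hB : ∀ k ω, |ξ k ω| ≤ B) (h0 : ∀ k, ∫ ω, ξ k ω ∂μ = 0)
    (h1 : ∑ k, ∫ ω, ξ k ω ^ 2 ∂μ = 1) {T : Ω → ℝ} (hT : Measurable T)
    (hi : Integrable (fun ω => T ω - ∑ k, ξ k ω) μ) {r : ℝ}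
    (hr : ∫ ω, |T ω - ∑ k, ξ k ω| ∂μ ≤ r) {ε : ℝ} (hε : 0 < ε) (z : ℝ) :
    |μ.real {ω | T ω ≤ z} - stdNormalCdf z| ≤ ε + 2 * B * (7 + 1 / ε) + r / ε := by
  have mW : Measurable fun ω => ∑ k, ξ k ω := Finset.measurable_fun_sum _ fun k _ => hm k
  have hTW (z : ℝ) : |∫ ω, ramp z ε (T ω) ∂μ - ∫ ω, ramp z ε (∑ k, ξ k ω) ∂μ| ≤ r / ε := by
    rw [← integral_sub (integrable_ramp_comp hT z ε) (integrable_ramp_comp mW z ε)]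
    calc _ ≤ ∫ ω, |ramp z ε (T ω) - ramp z ε (∑ k, ξ k ω)| ∂μ := abs_integral_le_integral_abs
      _ ≤ ∫ ω, 1 / ε * |T ω - ∑ k, ξ k ω| ∂μ :=
          integral_mono ((integrable_ramp_comp hT z ε).sub (integrable_ramp_comp mW z ε)).abs
            (hi.abs.const_mul _) fun ω => abs_ramp_sub_ramp_le hε _ _
      _ = 1 / ε * ∫ ω, |T ω - ∑ k, ξ k ω| ∂μ := integral_const_mul _ _
      _ ≤ 1 / ε * r := by gcongr
      _ = r / ε := by ring
  have hWG (z : ℝ) : |∫ ω, ramp z ε (∑ k, ξ k ω) ∂μ - ∫ x, ramp z ε x ∂gaussianReal 0 1|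
      ≤ 2 * B * (7 + 1 / ε) :=
    abs_integral_sum_sub_integral_gaussian_le hm hind hB h0 h1 (continuous_ramp z ε)
      (ramp_nonneg z ε) (ramp_le_one z ε) (by positivity) (abs_ramp_sub_ramp_le hε)
  -- The ramp descending after `z` bounds the probability from above, the one descending before `z`
  -- from below; both return to the Gaussian at a cost of `ε`.
  have u1 := measureReal_le_integral_ramp (μ := μ) hT hε z
  have u2 := integral_ramp_le_measureReal (μ := gaussianReal 0 1) measurable_id hε z
  have l1 := integral_ramp_le_measureReal (μ := μ) hT hε (z - ε)
  have l2 := measureReal_le_integral_ramp (μ := gaussianReal 0 1) measurable_id hε (z - ε)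
  have c1 := stdNormalCdf_add_le hε.le z
  have c2 := stdNormalCdf_add_le hε.le (z - ε)
  rw [sub_add_cancel] at l1 c2
  simp only [id] at u2 l2
  change _ ≤ (gaussianReal 0 1).real (Iic (z + ε)) at u2
  change (gaussianReal 0 1).real (Iic (z - ε)) ≤ _ at l2
  rw [← stdNormalCdf_eq] at u2 l2
  have a1 := abs_le.1 (hTW z)
  have a2 := abs_le.1 (hTW (z - ε))
  have a3 := abs_le.1 (hWG z)
  have a4 := abs_le.1 (hWG (z - ε))
  rw [abs_le]
  constructor <;> linarith

/-! ### Moments of the sample proportions -/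

section SampleProportion

variable {Ω A : Type*} {n : ℕ}

lemma sampleProportion_nonneg (X : Fin n → Ω → A) (b : A) (ω : Ω) :
    0 ≤ sampleProportion X b ω :=
  mul_nonneg (by positivity)
    (Finset.sum_nonneg fun _ _ => indicator_nonneg (fun _ _ => zero_le_one) _)

lemma sampleProportion_le_one (X : Fin n → Ω → A) (b : A) (ω : Ω) :
    sampleProportion X b ω ≤ 1 := by
  have : ∑ k : Fin n, ({ω' | X k ω' = b}).indicator (fun _ => (1 : ℝ)) ω ≤ n := by
    calc _ ≤ ∑ _k : Fin n, (1 : ℝ) :=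
          Finset.sum_le_sum fun k _ => indicator_le_self' (fun _ _ => zero_le_one) ω
      _ = n := by simp
  rw [sampleProportion, one_div_mul_eq_div]
  exact div_le_one_of_le₀ this (Nat.cast_nonneg n)

lemma sampleProportion_mem_Icc (X : Fin n → Ω → A) (b : A) (ω : Ω) :
    sampleProportion X b ω ∈ Icc (0 : ℝ) 1 :=
  ⟨sampleProportion_nonneg X b ω, sampleProportion_le_one X b ω⟩

/-- A weighted sum of the sample proportions is a sample mean. -/
lemma hasSum_mul_sampleProportion (a : ℕ ≃ A) (X : Fin n → Ω → A) (c : ℕ → ℝ) (ω : Ω) :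
    HasSum (fun i => c i * sampleProportion X (a i) ω)
      (1 / (n : ℝ) * ∑ k, c (a.symm (X k ω))) := by
  have h (k : Fin n) : HasSum
      (fun i => c i * ({ω' | X k ω' = a i}).indicator (fun _ => (1 : ℝ)) ω)
      (c (a.symm (X k ω))) := by
    convert hasSum_single (f := fun i =>
      c i * ({ω' | X k ω' = a i}).indicator (fun _ => (1 : ℝ)) ω) (a.symm (X k ω)) ?_ using 1
    · simp
    · intro i hi
      have : ω ∉ {ω' | X k ω' = a i} := fun h : X k ω = a i => hi (by rw [h, a.symm_apply_apply])
      simp [indicator_of_notMem this]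
  refine ((hasSum_sum fun k (_ : k ∈ Finset.univ) => h k).mul_left (1 / (n : ℝ))).congr_fun
    fun i => ?_
  simp only [sampleProportion, Finset.mul_sum]
  exact Finset.sum_congr rfl fun k _ => by ring

/-- Only finitely many letters occur in a sample. -/
lemma summable_comp_sampleProportion (a : ℕ ≃ A) (X : Fin n → Ω → A) {g : ℝ → ℝ} (hg : g 0 = 0)
    (ω : Ω) : Summable fun i => g (sampleProportion X (a i) ω) := by
  classical
  refine summable_of_ne_finset_zero (s := Finset.univ.image fun k => a.symm (X k ω)) fun i hi => ?_
  have : sampleProportion X (a i) ω = 0 := by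
    refine mul_eq_zero_of_right (1 / (n : ℝ)) (Finset.sum_eq_zero fun k _ => ?_)
    refine indicator_of_notMem (s := {ω' | X k ω' = a i}) (fun h => hi ?_) fun _ => (1 : ℝ)
    change X k ω = a i at h
    exact Finset.mem_image.2 ⟨k, Finset.mem_univ k, by rw [h, a.symm_apply_apply]⟩
  rw [this, hg]

lemma sampleProportion_sub_eq (X : Fin n → Ω → A) (b : A) (hn : 1 ≤ n) (q : ℝ) (ω : Ω) : sampleProportion X b ω - q
    = 1 / (n : ℝ) * ∑ k, (({ω' | X k ω' = b}).indicator (fun _ => (1 : ℝ)) ω - q) := by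
  have : (n : ℝ) ≠ 0 := by positivity
  rw [sampleProportion, Finset.sum_sub_distrib]
  simp
  field_simp

lemma abs_sampleProportion_sub_le_one {X : Fin n → Ω → A} {b : A} {q : ℝ} (hq0 : 0 ≤ q) (hq1 : q ≤ 1) (ω : Ω) :
    |sampleProportion X b ω - q| ≤ 1 := by
  have := sampleProportion_mem_Icc X b ω
  rw [abs_le]
  constructor <;> linarith [this.1, this.2]

variable [MeasurableSpace A] [MeasurableSingletonClass A] [MeasurableSpace Ω] {μ : Measure Ω}
  {X : Fin n → Ω → A} {b : A} {q : ℝ}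

lemma measurable_sampleProportion (hX : ∀ k, Measurable (X k)) (b : A) :
    Measurable (sampleProportion X b) := by
  refine (Finset.measurable_fun_sum _ fun k _ => ?_).const_mul _
  exact measurable_const.indicator (hX k (measurableSet_singleton b))

lemma integral_indicator_letter (hX : ∀ k, Measurable (X k))
    (hq : ∀ k, μ.real {ω | X k ω = b} = q) (k : Fin n) :
    ∫ ω, ({ω' | X k ω' = b}).indicator (fun _ => (1 : ℝ)) ω ∂μ = q := by
  rw [← hq k]
  exact integral_indicator_one (hX k (measurableSet_singleton b))

variable [IsProbabilityMeasure μ]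

lemma integrable_indicator_letter (hX : ∀ k, Measurable (X k)) (k : Fin n) :
    Integrable (fun ω => ({ω' | X k ω' = b}).indicator (fun _ => (1 : ℝ)) ω) μ :=
  (integrable_const (1 : ℝ)).indicator (hX k (measurableSet_singleton b))

/-- Both the proportion and `q` are nonnegative with mean `q`. For rare letters (`q` below `1 / n`)
this beats the `√(q / n)` of Cauchy–Schwarz, and it is summable over the alphabet. -/
lemma integral_abs_sampleProportion_sub_le (hn : 1 ≤ n) (hX : ∀ k, Measurable (X k))
    (hq : ∀ k, μ.real {ω | X k ω = b} = q) (hq0 : 0 ≤ q) :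
    ∫ ω, |sampleProportion X b ω - q| ∂μ ≤ 2 * q := by
  have hn0 : (n : ℝ) ≠ 0 := by positivity
  have hi (k : Fin n) := integrable_indicator_letter (μ := μ) (b := b) hX k
  have hmean : ∫ ω, sampleProportion X b ω ∂μ = q := by
    simp only [sampleProportion]
    rw [integral_const_mul, integral_finsetSum _ fun k _ => hi k]
    simp only [integral_indicator_letter hX hq]
    simp
    field_simp
  have ip : Integrable (sampleProportion X b) μ :=
    integrable_of_forall_abs_le (measurable_sampleProportion hX b) 1 fun ω => by
      rw [abs_of_nonneg (sampleProportion_nonneg _ _ _)]; exact sampleProportion_le_one _ _ _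
  calc ∫ ω, |sampleProportion X b ω - q| ∂μ ≤ ∫ ω, (sampleProportion X b ω + q) ∂μ := by
        refine integral_mono (ip.sub (integrable_const q)).abs (ip.add (integrable_const q))
          fun ω => ?_
        have := sampleProportion_nonneg X b ω
        dsimp only
        rw [abs_le]; constructor <;> linarith
    _ = 2 * q := by
        rw [integral_add ip (integrable_const q), hmean]; simp; ring

lemma integral_sampleProportion_sub_sq_le (hn : 1 ≤ n) (hX : ∀ k, Measurable (X k))
    (hind : iIndepFun X μ) (hq : ∀ k, μ.real {ω | X k ω = b} = q) (hq0 : 0 ≤ q) (hq1 : q ≤ 1) :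
    ∫ ω, (sampleProportion X b ω - q) ^ 2 ∂μ ≤ q / n := by
  have hn0 : (n : ℝ) ≠ 0 := by positivity
  set ξ : Fin n → Ω → ℝ := fun k ω => ({ω' | X k ω' = b}).indicator (fun _ => (1 : ℝ)) ω - q
    with hξ
  have hi (k : Fin n) := integrable_indicator_letter (μ := μ) (b := b) hX k
  have mξ (k : Fin n) : Measurable (ξ k) :=
    (measurable_const.indicator (hX k (measurableSet_singleton b))).sub_const q
  have hξ01 (k : Fin n) (ω : Ω) : ξ k ω = 1 - q ∨ ξ k ω = -q := by
    by_cases h : X k ω = b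
    · left; simp [hξ, indicator, h]
    · right; simp [hξ, indicator, h]
  have iξ : iIndepFun ξ μ := by
    have h := hind.comp (fun _ x => ({b} : Set A).indicator (fun _ => (1 : ℝ)) x - q)
      fun _ => (measurable_const.indicator (measurableSet_singleton b)).sub_const q
    exact h
  have bξ (k : Fin n) (ω : Ω) : |ξ k ω| ≤ 1 := by
    rw [abs_le]
    rcases hξ01 k ω with h | h <;> rw [h] <;> constructor <;> linarith
  have zξ (k : Fin n) : ∫ ω, ξ k ω ∂μ = 0 := by
    simp only [hξ]
    rw [integral_sub (hi k) (integrable_const q), integral_indicator_letter hX hq]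
    simp
  have sξ (k : Fin n) : ∫ ω, ξ k ω ^ 2 ∂μ ≤ q := by
    have e (ω : Ω) : ξ k ω ^ 2
        = (1 - 2 * q) * ({ω' | X k ω' = b}).indicator (fun _ => (1 : ℝ)) ω + q ^ 2 := by
      by_cases h : X k ω = b <;> simp [hξ, indicator, h]
      ring
    simp only [e]
    rw [integral_add ((hi k).const_mul _) (integrable_const _), integral_const_mul,
      integral_indicator_letter hX hq]
    simp
    nlinarith
  have e (ω : Ω) : (sampleProportion X b ω - q) ^ 2
      = (1 / (n : ℝ)) ^ 2 * (∑ k, ξ k ω) ^ 2 := by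
    rw [sampleProportion_sub_eq X b hn, mul_pow]
  simp only [e]
  rw [integral_const_mul, integral_sum_sq_eq_sum mξ iξ bξ zξ]
  calc (1 / (n : ℝ)) ^ 2 * ∑ k, ∫ ω, ξ k ω ^ 2 ∂μ ≤ (1 / (n : ℝ)) ^ 2 * ∑ _k : Fin n, q := by
        gcongr with k _; exact sξ k
    _ = q / n := by simp; field_simp

lemma integrable_sampleProportion_sub_sq (hX : ∀ k, Measurable (X k)) (hq0 : 0 ≤ q) (hq1 : q ≤ 1) :
    Integrable (fun ω => (sampleProportion X b ω - q) ^ 2) μ := by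
  refine integrable_of_forall_abs_le
    (((measurable_sampleProportion hX b).sub_const q).pow_const 2) 1 fun ω => ?_
  have := sampleProportion_mem_Icc X b ω
  rw [abs_of_nonneg (sq_nonneg _), sq_le_one_iff_abs_le_one, abs_le]
  constructor <;> linarith [this.1, this.2]

lemma integrable_abs_sampleProportion_sub (hX : ∀ k, Measurable (X k)) (hq0 : 0 ≤ q)
    (hq1 : q ≤ 1) : Integrable (fun ω => |sampleProportion X b ω - q|) μ :=
  integrable_of_forall_abs_le ((measurable_sampleProportion hX b).sub_const q).abs 1 fun ω => by
    rw [abs_abs]; exact abs_sampleProportion_sub_le_one hq0 hq1 ω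

lemma integrable_abs_sampleProportion_sub_rpow (hX : ∀ k, Measurable (X k)) (hq0 : 0 ≤ q)
    (hq1 : q ≤ 1) {s : ℝ} (hs : 0 ≤ s) :
    Integrable (fun ω => |sampleProportion X b ω - q| ^ s) μ :=
  integrable_of_forall_abs_le (((measurable_sampleProportion hX b).sub_const q).abs.pow_const s) 1
    fun ω => by
      rw [abs_of_nonneg (by positivity)]
      exact Real.rpow_le_one (abs_nonneg _) (abs_sampleProportion_sub_le_one hq0 hq1 ω) hs

lemma Real.rpow_le_add_sq {u s : ℝ} (hu : 0 ≤ u) (h1 : 1 ≤ s) (h2 : s ≤ 2) : u ^ s ≤ u + u ^ 2 := by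
  rcases le_total u 1 with h | h
  · have := Real.rpow_le_rpow_of_exponent_ge_of_imp hu h h1 (by grind)
    rw [Real.rpow_one] at this
    nlinarith [sq_nonneg u]
  · have := Real.rpow_le_rpow_of_exponent_le h h2
    rw [Real.rpow_two] at this
    linarith

lemma Real.rpow_le_one_add_sq {u s : ℝ} (hu : 0 ≤ u) (h1 : 1 ≤ s) (h2 : s ≤ 2) :
    u ^ s ≤ 1 + u ^ 2 := by
  rcases le_total u 1 with h | h
  · have := Real.rpow_le_one hu h (by linarith : 0 ≤ s)
    nlinarith [sq_nonneg u]
  · have := Real.rpow_le_rpow_of_exponent_le h h2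
    rw [Real.rpow_two] at this
    linarith

/-- A moment bound for the sample proportion that is linear in the probability of the letter. -/
lemma integral_abs_sampleProportion_sub_rpow_le_linear (hn : 1 ≤ n) (hX : ∀ k, Measurable (X k))
    (hind : iIndepFun X μ) (hq : ∀ k, μ.real {ω | X k ω = b} = q) (hq0 : 0 ≤ q) (hq1 : q ≤ 1)
    {s : ℝ} (h1 : 1 ≤ s) (h2 : s ≤ 2) :
    ∫ ω, |sampleProportion X b ω - q| ^ s ∂μ ≤ 3 * (n : ℝ) ^ (1 - s) * q := by
  have hn0 : (0 : ℝ) < n := by positivity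
  have ia := integrable_abs_sampleProportion_sub (μ := μ) (b := b) hX hq0 hq1
  have is := integrable_sampleProportion_sub_sq (μ := μ) (b := b) hX hq0 hq1
  -- The power is interpolated on the scale of counts, `n * |p̂ - q|`, where the first moment is at
  -- most `2 * n * q` and the second at most `n * q`; hence the constant 3.
  have hp (ω : Ω) : |sampleProportion X b ω - q| ^ s ≤ (n : ℝ) ^ (-s) *
      (n * |sampleProportion X b ω - q| + n ^ 2 * (sampleProportion X b ω - q) ^ 2) := by
    have := Real.rpow_le_add_sq (u := n * |sampleProportion X b ω - q|) (by positivity) h1 h2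
    rw [Real.mul_rpow hn0.le (abs_nonneg _), mul_pow, sq_abs] at this
    rw [Real.rpow_neg hn0.le, ← div_eq_inv_mul, le_div_iff₀ (by positivity)]
    linarith
  calc _ ≤ ∫ ω, (n : ℝ) ^ (-s) *
        (n * |sampleProportion X b ω - q| + n ^ 2 * (sampleProportion X b ω - q) ^ 2) ∂μ :=
        integral_mono (integrable_abs_sampleProportion_sub_rpow hX hq0 hq1 (by linarith))
          (((ia.const_mul _).add (is.const_mul _)).const_mul _) hp
    _ = (n : ℝ) ^ (-s) * (n * ∫ ω, |sampleProportion X b ω - q| ∂μ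
          + n ^ 2 * ∫ ω, (sampleProportion X b ω - q) ^ 2 ∂μ) := by
        rw [integral_const_mul, integral_add (ia.const_mul _) (is.const_mul _),
          integral_const_mul, integral_const_mul]
    _ ≤ (n : ℝ) ^ (-s) * (n * (2 * q) + n ^ 2 * (q / n)) := by
        gcongr
        · exact integral_abs_sampleProportion_sub_le hn hX hq hq0
        · exact integral_sampleProportion_sub_sq_le hn hX hind hq hq0 hq1
    _ = 3 * (n : ℝ) ^ (1 - s) * q := by
        rw [sub_eq_add_neg, Real.rpow_add hn0, Real.rpow_one]
        field_simp
        ring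

/-- The moment bound for the sample proportion by its variance. -/
lemma integral_abs_sampleProportion_sub_rpow_le_variance (hn : 1 ≤ n) (hX : ∀ k, Measurable (X k))
    (hind : iIndepFun X μ) (hq : ∀ k, μ.real {ω | X k ω = b} = q) (hq0 : 0 ≤ q) (hq1 : q ≤ 1)
    {s : ℝ} (h1 : 1 ≤ s) (h2 : s ≤ 2) :
    ∫ ω, |sampleProportion X b ω - q| ^ s ∂μ ≤ 2 * (n : ℝ) ^ (-(s / 2)) * q ^ (s / 2) := by
  have hn0 : (0 : ℝ) < n := by positivity
  have ir := integrable_abs_sampleProportion_sub_rpow (μ := μ) (b := b) hX hq0 hq1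
    (by linarith : 0 ≤ s)
  -- For `q = 0` the scale `√(q / n)` vanishes and cannot be divided by, but the first moment is
  -- then already zero.
  rcases hq0.eq_or_lt with hz | hpos
  · have ia := integrable_abs_sampleProportion_sub (μ := μ) (b := b) hX hq0 hq1
    calc _ ≤ ∫ ω, |sampleProportion X b ω - q| ∂μ := by
          refine integral_mono ir ia fun ω => ?_
          have := Real.rpow_le_rpow_of_exponent_ge_of_imp (abs_nonneg _)
            (abs_sampleProportion_sub_le_one (X := X) (b := b) hq0 hq1 ω) h1 (by grind)
          rwa [Real.rpow_one] at this
      _ ≤ 2 * q := integral_abs_sampleProportion_sub_le hn hX hq hq0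
      _ ≤ _ := by rw [← hz]; simp; positivity
  · have is := integrable_sampleProportion_sub_sq (μ := μ) (b := b) hX hq0 hq1
    set t := √(q / n) with ht
    have ht0 : 0 < t := Real.sqrt_pos.2 (by positivity)
    have ht2 : t ^ 2 = q / n := Real.sq_sqrt (by positivity)
    have hts : t ^ s = (n : ℝ) ^ (-(s / 2)) * q ^ (s / 2) := by
      rw [ht, Real.sqrt_eq_rpow, ← Real.rpow_mul (by positivity), Real.div_rpow hq0 hn0.le,
        Real.rpow_neg hn0.le]
      field_simp
    -- Measured in units of `t`, the error has second moment at most 1, so its moment of order `s`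
    -- is at most 2.
    have hp (ω : Ω) : |sampleProportion X b ω - q| ^ s ≤
        t ^ s + t ^ s / t ^ 2 * (sampleProportion X b ω - q) ^ 2 := by
      have := Real.rpow_le_one_add_sq (u := |sampleProportion X b ω - q| / t) (by positivity) h1 h2
      rw [Real.div_rpow (abs_nonneg _) ht0.le, div_pow, sq_abs, div_le_iff₀ (by positivity)] at this
      calc _ ≤ _ := this
        _ = _ := by ring
    calc _ ≤ ∫ ω, (t ^ s + t ^ s / t ^ 2 * (sampleProportion X b ω - q) ^ 2) ∂μ :=
          integral_mono ir ((integrable_const _).add (is.const_mul _)) hp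
      _ = t ^ s + t ^ s / t ^ 2 * ∫ ω, (sampleProportion X b ω - q) ^ 2 ∂μ := by
          rw [integral_add (integrable_const _) (is.const_mul _), integral_const_mul]; simp
      _ ≤ t ^ s + t ^ s / t ^ 2 * t ^ 2 := by
          rw [ht2]
          gcongr
          exact integral_sampleProportion_sub_sq_le hn hX hind hq hq0 hq1
      _ = 2 * (n : ℝ) ^ (-(s / 2)) * q ^ (s / 2) := by
          rw [mul_assoc, ← hts]
          field_simp
          ring

end SampleProportion

/-! ### Taylor remainders and their summation -/

/-- The first-order Taylor bound for a function with Hölder continuous derivative. -/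
lemma abs_sub_sub_unitDeriv_mul_le {g : ℝ → ℝ} {β M : ℝ} (hβ : 0 ≤ β) (hM0 : 0 ≤ M)
    (hg : DifferentiableOn ℝ g (Icc (0 : ℝ) 1))
    (hM : ∀ x ∈ Icc (0 : ℝ) 1, ∀ y ∈ Icc (0 : ℝ) 1,
      |unitDeriv g x - unitDeriv g y| ≤ M * |x - y| ^ β)
    {x y : ℝ} (hx : x ∈ Icc (0 : ℝ) 1) (hy : y ∈ Icc (0 : ℝ) 1) :
    |g y - g x - unitDeriv g x * (y - x)| ≤ M * |y - x| ^ (β + 1) := by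
  have hsub : uIcc x y ⊆ Icc 0 1 := ordConnected_Icc.uIcc_subset hx hy
  have hd (s : ℝ) (hs : s ∈ uIcc x y) : HasDerivWithinAt (fun s => g s - unitDeriv g x * s)
      (unitDeriv g s - unitDeriv g x) (uIcc x y) s := by
    have h1 := ((hg s (hsub hs)).hasDerivWithinAt).mono hsub
    have h2 : HasDerivWithinAt (fun s => unitDeriv g x * s) (unitDeriv g x) (uIcc x y) s := by
      simpa using ((hasDerivAt_id s).const_mul (unitDeriv g x)).hasDerivWithinAt
    exact h1.fun_sub h2
  have hb (s : ℝ) (hs : s ∈ uIcc x y) : ‖unitDeriv g s - unitDeriv g x‖ ≤ M * |y - x| ^ β := by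
    exact (hM s (hsub hs) x hx).trans (mul_le_mul_of_nonneg_left
      (Real.rpow_le_rpow (abs_nonneg _) (abs_sub_left_of_mem_uIcc hs) hβ) hM0)
  have h := Convex.norm_image_sub_le_of_norm_hasDerivWithin_le hd hb (convex_uIcc x y)
    left_mem_uIcc right_mem_uIcc
  simp only [Real.norm_eq_abs] at h
  rcases eq_or_ne y x with rfl | hne
  · simp only [sub_self, mul_zero, abs_zero]; positivity
  · rw [Real.rpow_add_one (abs_ne_zero.2 (sub_ne_zero.2 hne)), ← mul_assoc]
    refine le_of_eq_of_le ?_ h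
    ring_nf

/-- The `q i` tend to `0`, so by continuity `g (q i)` tends to `g 0`, while terms of a convergent
series tend to `0`. Hence unobserved letters contribute nothing to the plug-in sum. -/
lemma eq_zero_at_zero_of_summable {g : ℝ → ℝ} (hg : DifferentiableOn ℝ g (Icc (0 : ℝ) 1))
    {q : ℕ → ℝ} (hq : ∀ i, q i ∈ Icc (0 : ℝ) 1) (hqs : Summable q)
    (hgs : Summable fun i => |g (q i)|) : g 0 = 0 := by
  have h1 : Filter.Tendsto q Filter.atTop (nhdsWithin 0 (Icc 0 1)) :=
    tendsto_nhdsWithin_iff.2 ⟨hqs.tendsto_atTop_zero, .of_forall hq⟩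
  have h2 : Filter.Tendsto (fun i => g (q i)) Filter.atTop (nhds (g 0)) :=
    (hg.continuousOn 0 (by simp)).tendsto.comp h1
  exact tendsto_nhds_unique h2 hgs.of_abs.tendsto_atTop_zero

/-- Tonelli for nonnegative extended integrals. Pointwise summability is not needed, because a
divergent `tsum` is `0` and still obeys the norm bound. -/
lemma integrable_and_integral_abs_le_of_eq_tsum {Ω : Type*} [MeasurableSpace Ω] {μ : Measure Ω}
    {r : ℕ → Ω → ℝ} {c : ℕ → ℝ} (hc : Summable c) (hr : ∀ i, Integrable (r i) μ)
    (hrc : ∀ i, ∫ ω, |r i ω| ∂μ ≤ c i) {R : Ω → ℝ} (hRm : AEStronglyMeasurable R μ)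
    (hR : ∀ ω, R ω = ∑' i, r i ω) :
    Integrable R μ ∧ ∫ ω, |R ω| ∂μ ≤ ∑' i, c i := by
  have hc0 (i : ℕ) : 0 ≤ c i := (integral_nonneg fun ω => abs_nonneg _).trans (hrc i)
  have key : ∫⁻ ω, ‖R ω‖ₑ ∂μ ≤ ENNReal.ofReal (∑' i, c i) := by
    calc ∫⁻ ω, ‖R ω‖ₑ ∂μ ≤ ∫⁻ ω, ∑' i, ‖r i ω‖ₑ ∂μ :=
          lintegral_mono fun ω => by rw [hR]; exact enorm_tsum_le_tsum_enorm
      _ = ∑' i, ∫⁻ ω, ‖r i ω‖ₑ ∂μ :=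
          lintegral_tsum fun i => (hr i).aestronglyMeasurable.enorm
      _ ≤ ∑' i, ENNReal.ofReal (c i) := by
          refine ENNReal.tsum_le_tsum fun i => ?_
          rw [← ofReal_integral_norm_eq_lintegral_enorm (hr i)]
          exact ENNReal.ofReal_le_ofReal (hrc i)
      _ = ENNReal.ofReal (∑' i, c i) := (ENNReal.ofReal_tsum_of_nonneg hc0 hc).symm
  refine ⟨⟨hRm, key.trans_lt ENNReal.ofReal_lt_top⟩, ?_⟩
  have := integral_norm_eq_lintegral_enorm hRm
  simp only [Real.norm_eq_abs] at this
  rw [this]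
  exact ENNReal.toReal_le_of_le_ofReal (tsum_nonneg hc0) key

/-! ### Normal approximation at a fixed sample size -/

section Letters

variable {Ω A : Type*} {n : ℕ} [MeasurableSpace A] [MeasurableSingletonClass A] [MeasurableSpace Ω]
  {μ : Measure Ω} [IsProbabilityMeasure μ]

lemma integral_comp_letter (a : ℕ ≃ A) {Y : Ω → A} (hY : Measurable Y) {q : ℕ → ℝ}
    (hq : ∀ i, μ.real {ω | Y ω = a i} = q i) {u : ℕ → ℝ} {C : ℝ} (hu : ∀ i, |u i| ≤ C) :
    ∫ ω, u (a.symm (Y ω)) ∂μ = ∑' i, q i * u i := by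
  have : Countable A := a.symm.injective.countable
  have : IsProbabilityMeasure (μ.map Y) := Measure.isProbabilityMeasure_map hY.aemeasurable
  have hm : Measurable fun x : A => u (a.symm x) := .of_discrete
  rw [← integral_map (f := fun x => u (a.symm x)) hY.aemeasurable hm.aestronglyMeasurable,
    integral_countable (integrable_of_forall_abs_le hm C fun x => hu _), ← a.tsum_eq]
  refine tsum_congr fun i => ?_
  rw [map_measureReal_apply hY (measurableSet_singleton _), a.symm_apply_apply, smul_eq_mul, ← hq i]
  rfl

/-- The estimator factors through the countable discrete space of samples, on which every function
is measurable; nothing is asked of `g`. -/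
lemma measurable_plugIn (a : ℕ ≃ A) {X : Fin n → Ω → A} (hX : ∀ k, Measurable (X k)) (g : ℝ → ℝ) :
    Measurable (plugIn g a X) := by
  have : Countable A := a.symm.injective.countable
  have hF : Measurable (plugIn g a fun (k : Fin n) (x : Fin n → A) => x k) := .of_discrete
  exact hF.comp (measurable_pi_lambda _ hX)

/-- Normal approximation of the plug-in estimator for one sample size. -/
lemma abs_measureReal_plugIn_sub_le (a : ℕ ≃ A) (hn : 1 ≤ n) {X : Fin n → Ω → A}
    (hX : ∀ k, Measurable (X k)) (hind : iIndepFun X μ) {q : ℕ → ℝ} (hq0 : ∀ i, 0 ≤ q i)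
    (hqs : HasSum q 1) (hlaw : ∀ k i, μ.real {ω | X k ω = a i} = q i) {g : ℝ → ℝ} {β K M : ℝ}
    (hβ : 0 ≤ β) (hM0 : 0 ≤ M) (hg : DifferentiableOn ℝ g (Icc (0 : ℝ) 1))
    (hgs : Summable fun i => |g (q i)|) (hK : ∀ x ∈ Icc (0 : ℝ) 1, |unitDeriv g x| ≤ K)
    (hM : ∀ x ∈ Icc (0 : ℝ) 1, ∀ y ∈ Icc (0 : ℝ) 1,
      |unitDeriv g x - unitDeriv g y| ≤ M * |x - y| ^ β)
    {c : ℕ → ℝ} (hc : Summable c)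
    (hmom : ∀ i, ∫ ω, |sampleProportion X (a i) ω - q i| ^ (β + 1) ∂μ ≤ c i)
    (hσ : 0 < sigma g q) {ε : ℝ} (hε : 0 < ε) (z : ℝ) :
    |μ.real {ω | Real.sqrt n / sigma g q * (plugIn g a X ω - diversityIndex g q) ≤ z}
        - stdNormalCdf z|
      ≤ ε + 2 * (2 * K / (√n * sigma g q)) * (7 + 1 / ε)
        + √n / sigma g q * (M * ∑' i, c i) / ε := by
  have : Countable A := a.symm.injective.countable
  set σ := sigma g q with hσdef
  have hn0 : (0 : ℝ) < n := by positivity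
  have hsn : 0 < √(n : ℝ) := Real.sqrt_pos.2 hn0
  have hq (i : ℕ) : q i ∈ Icc (0 : ℝ) 1 := ⟨hq0 i, le_hasSum hqs i fun j _ => hq0 j⟩
  have hK0 : 0 ≤ K := (abs_nonneg _).trans (hK 0 (by simp))
  set d : ℕ → ℝ := fun i => unitDeriv g (q i) with hd
  have hdK (i : ℕ) : |d i| ≤ K := hK _ (hq i)
  have hg0 : g 0 = 0 := eq_zero_at_zero_of_summable hg hq hqs.summable hgs
  set m := ∑' i, q i * d i with hm
  have hqd : Summable fun i => q i * d i :=
    (hqs.summable.mul_right K).of_norm_bounded fun i => by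
      rw [Real.norm_eq_abs, abs_mul, abs_of_nonneg (hq0 i)]
      exact mul_le_mul_of_nonneg_left (hdK i) (hq0 i)
  have hmK : |m| ≤ K := by
    have h := hqs.mul_right K
    rw [one_mul] at h
    rw [← Real.norm_eq_abs]
    exact tsum_of_norm_bounded h fun i => by
      rw [Real.norm_eq_abs, abs_mul, abs_of_nonneg (hq0 i)]
      exact mul_le_mul_of_nonneg_left (hdK i) (hq0 i)
  have mY (k : Fin n) : Measurable fun ω => d (a.symm (X k ω)) :=
    (Measurable.of_discrete (f := fun x : A => d (a.symm x))).comp (hX k)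
  have iY (k : Fin n) : Integrable (fun ω => d (a.symm (X k ω))) μ :=
    integrable_of_forall_abs_le (mY k) K fun ω => hdK _
  have EY (k : Fin n) : ∫ ω, d (a.symm (X k ω)) ∂μ = m := integral_comp_letter a (hX k) (hlaw k) hdK
  have hσ2 : ∑' i, q i * d i ^ 2 - m ^ 2 = σ ^ 2 := by
    rw [hσdef, sigma, Real.sq_sqrt (Real.sqrt_pos.1 hσ).le, sigmaSq]
  have VY (k : Fin n) : ∫ ω, (d (a.symm (X k ω)) - m) ^ 2 ∂μ = σ ^ 2 := by
    have h2 (i : ℕ) : |d i ^ 2| ≤ K ^ 2 := by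
      rw [abs_pow]; exact pow_le_pow_left₀ (abs_nonneg _) (hdK i) 2
    have i2 : Integrable (fun ω => d (a.symm (X k ω)) ^ 2) μ :=
      integrable_of_forall_abs_le ((mY k).pow_const 2) (K ^ 2) fun ω => h2 _
    have e2 : ∫ ω, d (a.symm (X k ω)) ^ 2 ∂μ = ∑' i, q i * d i ^ 2 :=
      integral_comp_letter (u := fun i => d i ^ 2) a (hX k) (hlaw k) h2
    have e (ω : Ω) : (d (a.symm (X k ω)) - m) ^ 2
        = d (a.symm (X k ω)) ^ 2 - 2 * m * d (a.symm (X k ω)) + m ^ 2 := by ring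
    simp only [e]
    have i3 : Integrable (fun ω => d (a.symm (X k ω)) ^ 2 - 2 * m * d (a.symm (X k ω))) μ :=
      i2.sub ((iY k).const_mul _)
    rw [integral_add i3 (integrable_const _), integral_sub i2 ((iY k).const_mul _),
      integral_const_mul, EY, e2, ← hσ2]
    simp
    ring
  -- The normalised linear part: each draw contributes the derivative at its letter, minus the mean.
  set ξ : Fin n → Ω → ℝ := fun k ω => 1 / (√n * σ) * (d (a.symm (X k ω)) - m) with hξ
  have mξ (k : Fin n) : Measurable (ξ k) := ((mY k).sub_const m).const_mul _
  have iξ : iIndepFun ξ μ :=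
    hind.comp (fun _ x => 1 / (√n * σ) * (d (a.symm x) - m)) fun _ => .of_discrete
  have bξ (k : Fin n) (ω : Ω) : |ξ k ω| ≤ 2 * K / (√n * σ) := by
    rw [hξ, abs_mul, abs_of_pos (by positivity), one_div_mul_eq_div]
    gcongr
    have h1 := abs_le.1 (hdK (a.symm (X k ω)))
    have h2 := abs_le.1 hmK
    rw [abs_le]; constructor <;> linarith
  have zξ (k : Fin n) : ∫ ω, ξ k ω ∂μ = 0 := by
    simp only [hξ]
    rw [integral_const_mul, integral_sub (iY k) (integrable_const m), EY]
    simp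
  have vξ : ∑ k, ∫ ω, ξ k ω ^ 2 ∂μ = 1 := by
    simp only [hξ, mul_pow]
    simp only [integral_const_mul, VY]
    have := Real.sq_sqrt hn0.le
    simp only [Finset.sum_const, Finset.card_univ, Fintype.card_fin, nsmul_eq_mul, mul_pow,
      one_div, inv_pow, this]
    field_simp
  set T : Ω → ℝ := fun ω => √n / σ * (plugIn g a X ω - diversityIndex g q) with hT
  have mT : Measurable T := ((measurable_plugIn a hX g).sub_const _).const_mul _
  set r : ℕ → Ω → ℝ := fun i ω =>
    √n / σ * (g (sampleProportion X (a i) ω) - g (q i) - d i * (sampleProportion X (a i) ω - q i))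
    with hr
  -- All four series converge separately, so they combine termwise; the linear one is a sample mean.
  have hTr (ω : Ω) : T ω - ∑ k, ξ k ω = ∑' i, r i ω := by
    have s1 := (summable_comp_sampleProportion a X hg0 ω).hasSum
    have s2 := hgs.of_abs.hasSum
    have s3 := hasSum_mul_sampleProportion a X d ω
    have s4 := hqd.hasSum
    have s5 := (((s1.sub s2).sub (s3.sub s4)).mul_left (√n / σ)).tsum_eq
    have e : ∑' i, r i ω = ∑' i, √n / σ * (g (sampleProportion X (a i) ω) - g (q i)
        - (d i * sampleProportion X (a i) ω - q i * d i)) :=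
      tsum_congr fun i => by simp only [hr]; ring
    rw [e, s5]
    have hs : ∑ k, ξ k ω = √n / σ * (1 / (n : ℝ) * ∑ k, d (a.symm (X k ω)) - m) := by
      simp only [hξ]
      rw [← Finset.mul_sum, Finset.sum_sub_distrib]
      simp only [Finset.sum_const, Finset.card_univ, Fintype.card_fin, nsmul_eq_mul]
      have := Real.sq_sqrt hn0.le
      field_simp
      rw [this]
    rw [hs]
    simp only [hT, plugIn, diversityIndex]
    ring
  have mr (i : ℕ) : Measurable (r i) := by
    have hF : Measurable fun x : Fin n → A =>
        √n / σ * (g (sampleProportion (fun k (x : Fin n → A) => x k) (a i) x) - g (q i)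
          - d i * (sampleProportion (fun k (x : Fin n → A) => x k) (a i) x - q i)) := .of_discrete
    exact hF.comp (measurable_pi_lambda _ hX)
  have hrle (i : ℕ) (ω : Ω) :
      |r i ω| ≤ √n / σ * (M * |sampleProportion X (a i) ω - q i| ^ (β + 1)) := by
    rw [hr, abs_mul, abs_of_pos (by positivity)]
    gcongr
    exact abs_sub_sub_unitDeriv_mul_le hβ hM0 hg hM (hq i) (sampleProportion_mem_Icc X (a i) ω)
  have imom (i : ℕ) :
      Integrable (fun ω => √n / σ * (M * |sampleProportion X (a i) ω - q i| ^ (β + 1))) μ :=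
    ((integrable_abs_sampleProportion_sub_rpow hX (hq i).1 (hq i).2
      (by linarith : 0 ≤ β + 1)).const_mul M).const_mul _
  have ir (i : ℕ) : Integrable (r i) μ :=
    (imom i).mono' (mr i).aestronglyMeasurable (.of_forall (hrle i))
  have hrc (i : ℕ) : ∫ ω, |r i ω| ∂μ ≤ √n / σ * (M * c i) := by
    calc _ ≤ ∫ ω, √n / σ * (M * |sampleProportion X (a i) ω - q i| ^ (β + 1)) ∂μ :=
          integral_mono (ir i).abs (imom i) (hrle i)
      _ = √n / σ * (M * ∫ ω, |sampleProportion X (a i) ω - q i| ^ (β + 1) ∂μ) := by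
          rw [integral_const_mul, integral_const_mul]
      _ ≤ _ := by
          have := hmom i
          gcongr
  obtain ⟨iR, hR⟩ := integrable_and_integral_abs_le_of_eq_tsum ((hc.mul_left M).mul_left (√n / σ))
    ir hrc (mT.sub (Finset.measurable_fun_sum _ fun k _ => mξ k)).aestronglyMeasurable hTr
  rw [tsum_mul_left, tsum_mul_left] at hR
  exact abs_measureReal_sub_stdNormalCdf_le mξ iξ bξ zξ vξ mT iR hR hε z

end Letters

/-! ### Rates uniform in the sample size and the choice of smoothing width -/

lemma rateExponent_le_half {β : ℝ} (hβ : β ≤ 1) : rateExponent β ≤ 1 / 2 := by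
  unfold rateExponent; split_ifs <;> linarith

/-- The total moment of order `β + 1` of the errors of the sample proportions. -/
lemma exists_summable_moment_bound {A : Type*} [MeasurableSpace A] [MeasurableSingletonClass A]
    (a : ℕ ≃ A) (p : ℕ → ℕ → ℝ) (hp_nonneg : ∀ n, 1 ≤ n → ∀ i, 0 ≤ p n i)
    (hp_sum : ∀ n, 1 ≤ n → HasSum (p n) 1)
    {Ω : ℕ → Type*} [∀ n, MeasurableSpace (Ω n)]
    (P : ∀ n, Measure (Ω n)) [∀ n, IsProbabilityMeasure (P n)]
    (X : ∀ n, Fin n → Ω n → A)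
    (hX_meas : ∀ n, 1 ≤ n → ∀ k, Measurable (X n k))
    (hX_indep : ∀ n, 1 ≤ n → iIndepFun (X n) (P n))
    (hX_law : ∀ n, 1 ≤ n → ∀ k i, (P n).real {ω | X n k ω = a i} = p n i)
    {β : ℝ} (hβ_pos : 0 < β) (hβ_le : β ≤ 1)
    (hcase : 1 / 2 < β ∨
      (β ≤ 1 / 2 ∧
        (⨆ n : ℕ, ⨆ _ : 1 ≤ n, ∑' i, ENNReal.ofReal (p n i ^ ((β + 1) / 2))) < ∞)) :
    ∃ C : ℝ, 0 ≤ C ∧ ∀ n : ℕ, 1 ≤ n → ∃ c : ℕ → ℝ, Summable c ∧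
      (∀ i, ∫ ω, |sampleProportion (X n) (a i) ω - p n i| ^ (β + 1) ∂P n ≤ c i) ∧
      √n * ∑' i, c i ≤ C * (n : ℝ) ^ (-rateExponent β) := by
  have hp1 (n : ℕ) (hn : 1 ≤ n) (i : ℕ) : p n i ≤ 1 :=
    le_hasSum (hp_sum n hn) i fun j _ => hp_nonneg n hn j
  rcases hcase with hβ | ⟨hβ, hsup⟩
  · refine ⟨3, by norm_num, fun n hn => ⟨fun i => 3 * (n : ℝ) ^ (1 - (β + 1)) * p n i,
      (hp_sum n hn).summable.mul_left _, fun i => ?_, ?_⟩⟩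
    · exact integral_abs_sampleProportion_sub_rpow_le_linear hn (hX_meas n hn) (hX_indep n hn)
        (fun k => hX_law n hn k i) (hp_nonneg n hn i) (hp1 n hn i) (by linarith) (by linarith)
    · have hn0 : (0 : ℝ) < n := by positivity
      rw [tsum_mul_left, (hp_sum n hn).tsum_eq, rateExponent, if_neg (not_le.2 hβ),
        Real.sqrt_eq_rpow, mul_one, mul_left_comm, ← Real.rpow_add hn0]
      apply le_of_eq
      ring_nf
  · set s := ⨆ n : ℕ, ⨆ _ : 1 ≤ n, ∑' i, ENNReal.ofReal (p n i ^ ((β + 1) / 2)) with hs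
    refine ⟨2 * s.toReal, by positivity, fun n hn => ?_⟩
    have hle : ∑' i, ENNReal.ofReal (p n i ^ ((β + 1) / 2)) ≤ s :=
      le_iSup₂ (f := fun (n : ℕ) (_ : 1 ≤ n) => ∑' i, ENNReal.ofReal (p n i ^ ((β + 1) / 2))) n hn
    have h0 (i : ℕ) : 0 ≤ p n i ^ ((β + 1) / 2) := Real.rpow_nonneg (hp_nonneg n hn i) _
    have hsum : Summable fun i => p n i ^ ((β + 1) / 2) := by
      have := ENNReal.summable_toReal (hle.trans_lt hsup).ne
      simpa only [ENNReal.toReal_ofReal (h0 _)] using this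
    have hts : ∑' i, p n i ^ ((β + 1) / 2) ≤ s.toReal := by
      rw [← ENNReal.ofReal_le_iff_le_toReal hsup.ne, ENNReal.ofReal_tsum_of_nonneg h0 hsum]
      exact hle
    refine ⟨fun i => 2 * (n : ℝ) ^ (-((β + 1) / 2)) * p n i ^ ((β + 1) / 2),
      hsum.mul_left _, fun i => ?_, ?_⟩
    · exact integral_abs_sampleProportion_sub_rpow_le_variance hn (hX_meas n hn) (hX_indep n hn)
        (fun k => hX_law n hn k i) (hp_nonneg n hn i) (hp1 n hn i) (by linarith) (by linarith)
    · have hn0 : (0 : ℝ) < n := by positivity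
      have e : √(n : ℝ) * (n : ℝ) ^ (-((β + 1) / 2)) = (n : ℝ) ^ (-rateExponent β) := by
        rw [rateExponent, if_pos hβ, Real.sqrt_eq_rpow, ← Real.rpow_add hn0]
        ring_nf
      rw [tsum_mul_left, ← e]
      calc _ = 2 * (∑' i, p n i ^ ((β + 1) / 2)) * (√(n : ℝ) * (n : ℝ) ^ (-((β + 1) / 2))) := by
            ring
        _ ≤ _ := by gcongr

theorem theorem2p1
    -- the countably infinite alphabet, with its letters enumerated
    {A : Type*} [MeasurableSpace A] [MeasurableSingletonClass A] (a : ℕ ≃ A)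
    -- the distributions on the alphabet, one for each sample size `n ≥ 1`
    (p : ℕ → ℕ → ℝ)
    (hp_nonneg : ∀ n, 1 ≤ n → ∀ i, 0 ≤ p n i)
    (hp_sum : ∀ n, 1 ≤ n → HasSum (p n) 1)
    -- the rows of the triangular array: i.i.d. samples of size `n` with the `n`-th distribution
    {Ω : ℕ → Type*} [∀ n, MeasurableSpace (Ω n)]
    (P : ∀ n, Measure (Ω n)) [∀ n, IsProbabilityMeasure (P n)]
    (X : ∀ n, Fin n → Ω n → A)
    (hX_meas : ∀ n, 1 ≤ n → ∀ k, Measurable (X n k))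
    (hX_indep : ∀ n, 1 ≤ n → iIndepFun (X n) (P n))
    (hX_law : ∀ n, 1 ≤ n → ∀ k i, (P n).real {ω | X n k ω = a i} = p n i)
    -- the function `g` on `[0,1]`; its values elsewhere play no role
    (g : ℝ → ℝ) (β : ℝ) (hβ_pos : 0 < β) (hβ_le : β ≤ 1)
    (hg_summable : ∀ n, 1 ≤ n → Summable (fun i => |g (p n i)|))
    (hg_diff : DifferentiableOn ℝ g (Icc (0 : ℝ) 1))
    (hg_holder : HolderUnit β (unitDeriv g))
    (hcase : 1 / 2 < β ∨
      (β ≤ 1 / 2 ∧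
        (⨆ n : ℕ, ⨆ _ : 1 ≤ n, ∑' i, ENNReal.ofReal (p n i ^ ((β + 1) / 2))) < ∞)) :
    ∃ C : ℝ, 0 < C ∧ ∀ n : ℕ, 1 ≤ n → 0 < sigma g (p n) →
      (⨆ x : ℝ,
        |(P n).real {ω | Real.sqrt n / sigma g (p n) *
            (plugIn g a (X n) ω - diversityIndex g (p n)) ≤ x} - stdNormalCdf x|)
        ≤ C / ((n : ℝ) ^ (rateExponent β / 2) * sigma g (p n) ^ (1 / 2 : ℝ)) := by
  obtain ⟨M, hM0, hM⟩ := hg_holder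
  obtain ⟨C₁, hC₁, hmom⟩ := exists_summable_moment_bound a p hp_nonneg hp_sum P X hX_meas hX_indep
    hX_law hβ_pos hβ_le hcase
  set K := |unitDeriv g 0| + M with hKdef
  have hK0 : 0 ≤ K := by positivity
  have hK (x : ℝ) (hx : x ∈ Icc (0 : ℝ) 1) : |unitDeriv g x| ≤ K := by
    have h1 := hM x hx 0 (by simp)
    have h2 : |x - 0| ^ β ≤ 1 := by
      rw [sub_zero, abs_of_nonneg hx.1]
      exact Real.rpow_le_one hx.1 hx.2 hβ_pos.le
    have h3 : |unitDeriv g x| - |unitDeriv g 0| ≤ |unitDeriv g x - unitDeriv g 0| :=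
      abs_sub_abs_le_abs_sub _ _
    nlinarith
  -- The summands pay for the smoothing width, the Stein error and the Taylor remainder; the `1`
  -- alone covers the trivial case `1 ≤ ε`.
  refine ⟨1 + 32 * K + M * C₁, by positivity, fun n hn hσ => ?_⟩
  obtain ⟨c, hc, hci, hcn⟩ := hmom n hn
  set γ := rateExponent β with hγ
  set σ := sigma g (p n) with hσdef
  have hn0 : (0 : ℝ) < n := by positivity
  have hsn : 0 < √(n : ℝ) := Real.sqrt_pos.2 hn0
  set ε := √((n : ℝ) ^ (-γ) / σ) with hε
  have hε0 : 0 < ε := Real.sqrt_pos.2 (by positivity)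
  have hε2 : ε ^ 2 = (n : ℝ) ^ (-γ) / σ := Real.sq_sqrt (by positivity)
  have hrhs : (1 + 32 * K + M * C₁) / ((n : ℝ) ^ (γ / 2) * σ ^ (1 / 2 : ℝ))
      = (1 + 32 * K + M * C₁) * ε := by
    rw [hε, Real.sqrt_eq_rpow, Real.div_rpow (by positivity) hσ.le, ← Real.rpow_mul hn0.le,
      show -γ * (1 / 2) = -(γ / 2) by ring, Real.rpow_neg hn0.le]
    field_simp
  rw [hrhs]
  refine Real.iSup_le (fun x => ?_) (by positivity)
  rcases le_total 1 ε with h1 | h1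
  · have hΦ := stdNormalCdf_mem_Icc x
    have hP0 : 0 ≤ (P n).real {ω | √n / σ * (plugIn g a (X n) ω - diversityIndex g (p n)) ≤ x} :=
      measureReal_nonneg
    have hP1 : (P n).real {ω | √n / σ * (plugIn g a (X n) ω - diversityIndex g (p n)) ≤ x} ≤ 1 :=
      measureReal_le_one
    have hb : (1 : ℝ) ≤ (1 + 32 * K + M * C₁) * ε := by
      have : 0 ≤ (32 * K + M * C₁) * ε := by positivity
      linarith
    refine le_trans ?_ hb
    rw [abs_le]
    constructor <;> linarith [hΦ.1, hΦ.2]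
  · have h := abs_measureReal_plugIn_sub_le a hn (hX_meas n hn) (hX_indep n hn) (hp_nonneg n hn)
      (hp_sum n hn) (hX_law n hn) hβ_pos.le hM0.le hg_diff (hg_summable n hn) hK hM hc hci hσ hε0 x
    refine h.trans ?_
    rw [← hσdef]
    -- As `γ ≤ 1 / 2`, the size of the summands never exceeds the order of the remainder, so the
    -- same `ε` serves both.
    have hinv : 1 / (√n * σ) ≤ ε ^ 2 := by
      rw [hε2, ← div_div]
      gcongr
      rw [Real.sqrt_eq_rpow, one_div, ← Real.rpow_neg hn0.le]
      exact Real.rpow_le_rpow_of_exponent_le (by exact_mod_cast hn)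
        (neg_le_neg (rateExponent_le_half hβ_le))
    have t1 : 2 * (2 * K / (√n * σ)) * (7 + 1 / ε) ≤ 32 * K * ε := by
      calc 2 * (2 * K / (√n * σ)) * (7 + 1 / ε) = 4 * K * (1 / (√n * σ)) * (7 + 1 / ε) := by ring
        _ ≤ 4 * K * ε ^ 2 * (7 + 1 / ε) := by gcongr
        _ = 4 * K * ε * (7 * ε + 1) := by field_simp
        _ ≤ 4 * K * ε * (7 * 1 + 1) := by gcongr
        _ = 32 * K * ε := by ring
    have t2 : √n / σ * (M * ∑' i, c i) / ε ≤ M * C₁ * ε := by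
      calc √n / σ * (M * ∑' i, c i) / ε = M * (√n * ∑' i, c i) / σ / ε := by ring
        _ ≤ M * (C₁ * (n : ℝ) ^ (-γ)) / σ / ε := by gcongr
        _ = M * C₁ * ((n : ℝ) ^ (-γ) / σ) / ε := by ring
        _ = M * C₁ * ε := by rw [← hε2]; field_simp
    linarith
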